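/- Let $N\ge 3$ and $\frac{N}{N-1}<p<2$, and set $\alpha=(p-1)(N-1)$, $\beta=\frac{p-1}{\alpha-1}$, $\sigma=\frac{2-p}{p-1}$. Let $0<R\le\infty$ and $t\in(0,\infty]$, let $B_R=\{x\in\mathbb{R}^N:|x|<R\}$ (so $B_\infty=\mathbb{R}^N$), and put $$L_t(\phi)(x)=-\Delta\phi(x)+\frac{p\,x\cdot\nabla\phi(x)}{\beta|x|^2+t|x|^{\alpha+1}},\qquad L_\infty=-\Delta .$$ Let $X$ be the space of functions $\phi\in C^1(B_R\setminus\{0\})$ with $$\sup_{B_R\setminus\{0\}}\left\{|x|^\sigma|\phi(x)|+|x|^{\sigma+1}|\nabla\phi(x)|\right\}<\infty ,$$ which, if $R<\infty$, are continuous on $\overline{B_R}\setminus\{0\}$ with $\phi=0$ on $\partial B_R$. Let $X_1$ be the space of those $\phi\in X$ that have no $k=0$ spherical mode, that is, $\phi(r\theta)=\sum_{k\ge1}a_k(r)\psi_k(\theta)$ with convergence in $L^2(S^{N-1})$ for every $0<r<R$, where the $\psi_k$ $(k\ge 0)$ are smooth $L^2(S^{N-1})$-orthonormal eigenfunctions of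 the Laplace--Beltrami operator on $S^{N-1}$, $-\Delta_\theta\psi_k=\lambda_k\psi_k$, with $\lambda_0=0$ ($\psi_0$ constant) and $\lambda_k>0$ for $k\ge1$. If $\phi\in X_1$ satisfies $L_t(\phi)=0$ in $B_R\setminus\{0\}$ in the sense of distributions (in particular, if $\phi$ is a classical solution), then $\phi=0$ in $B_R\setminus\{0\}$. -/

import Mathlib

open scoped ENNReal ContDiff

noncomputable section

namespace SingularKernel

/-- Euclidean space `ℝ^N`. -/
abbrev E (N : ℕ) : Type := EuclideanSpace ℝ (Fin N)

/-- `α = (p - 1)(N - 1)`. -/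
def alpha (N : ℕ) (p : ℝ) : ℝ := (p - 1) * ((N : ℝ) - 1)

/-- `β = (p - 1) / (α - 1)`. -/
def beta (N : ℕ) (p : ℝ) : ℝ := (p - 1) / (alpha N p - 1)

/-- `σ = (2 - p) / (p - 1)`. -/
def sigma (p : ℝ) : ℝ := (2 - p) / (p - 1)

/-- The punctured open ball `B_R \ {0}`; for `R = ∞` this is `ℝ^N \ {0}`. -/
def puncturedBall (N : ℕ) (R : ℝ≥0∞) : Set (E N) := {x | x ≠ 0 ∧ ‖x‖ₑ < R}

/-- The punctured closed ball; for `R = ∞` this is `ℝ^N \ {0}`. -/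
def puncturedClosedBall (N : ℕ) (R : ℝ≥0∞) : Set (E N) := {x | x ≠ 0 ∧ ‖x‖ₑ ≤ R}

/-- The coefficient `p / (β |x|² + t |x|^(α+1))` of `x · ∇φ` in `L_t φ`.
It is zero for `t = ∞`, where `L_∞ = -Δ`. -/
def driftCoeff (N : ℕ) (p : ℝ) (t : ℝ≥0∞) (x : E N) : ℝ :=
  if t = ⊤ then 0
  else p / (beta N p * ‖x‖ ^ 2 + t.toReal * ‖x‖ ^ (alpha N p + 1))

/-- `L_t φ = -Δφ + p x·∇φ / (β |x|² + t |x|^(α+1)) = 0` in `B_R \ {0}`, in the sense of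
distributions, for a function `φ` that is `C¹` there.  Here `x · ∇φ(x)` is `fderiv ℝ φ x x`.
Every classical `C²` solution is a solution in this sense. -/
def SolvesLt (N : ℕ) (p : ℝ) (t R : ℝ≥0∞) (φ : E N → ℝ) : Prop :=
  ∀ η : E N → ℝ, ContDiff ℝ ∞ η → HasCompactSupport η → tsupport η ⊆ puncturedBall N R →
    ∫ x : E N, (-(φ x * Laplacian.laplacian η x)
      + driftCoeff N p t x * fderiv ℝ φ x x * η x) = 0

/-- The space `X` over `B_R`: functions that are `C¹` in `B_R \ {0}` with
`sup_{B_R \ {0}} (|x|^σ |φ(x)| + |x|^(σ+1) |∇φ(x)|) < ∞`, which, for finite `R`, are continuous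
up to `∂B_R` and vanish there.  (For `R = ∞` there is no `x` with `‖x‖ₑ = R`.) -/
structure MemX (N : ℕ) (p : ℝ) (R : ℝ≥0∞) (φ : E N → ℝ) : Prop where
  contDiffOn : ContDiffOn ℝ 1 φ (puncturedBall N R)
  bounded : ∃ C : ℝ, ∀ x ∈ puncturedBall N R,
    ‖x‖ ^ sigma p * |φ x| + ‖x‖ ^ (sigma p + 1) * ‖fderiv ℝ φ x‖ ≤ C
  continuousOn : ContinuousOn φ (puncturedClosedBall N R)
  boundary : ∀ x : E N, ‖x‖ₑ = R → φ x = 0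

/-- The extension of `ψ : S^{N-1} → ℝ` to `ℝ^N \ {0}` that is constant along rays.
Functions on the sphere are represented by functions on `ℝ^N`, of which only the values on
the sphere are used. -/
def radialExt {N : ℕ} (ψ : E N → ℝ) : E N → ℝ := fun x => ψ (‖x‖⁻¹ • x)

/-- The Laplace-Beltrami operator of `S^{N-1}`: the Euclidean Laplacian of the
extension that is constant along rays, evaluated on the sphere. -/
def sphereLaplacian {N : ℕ} (ψ : E N → ℝ) (θ : E N) : ℝ :=
  Laplacian.laplacian (radialExt ψ) θ

/-- `ψ` is smooth on `S^{N-1}` and `-Δ_θ ψ = l ψ` there. -/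
structure IsSphereEigenpair {N : ℕ} (ψ : E N → ℝ) (l : ℝ) : Prop where
  smooth : ContDiffOn ℝ ∞ (radialExt ψ) {0}ᶜ
  eigen : ∀ θ : E N, ‖θ‖ = 1 → -sphereLaplacian ψ θ = l * ψ θ

/-- The surface measure on `S^{N-1}`. -/
def sphereMeasure (N : ℕ) : MeasureTheory.Measure (Metric.sphere (0 : E N) 1) :=
  (MeasureTheory.volume : MeasureTheory.Measure (E N)).toSphere

/-- Eigenpairs `(ψ_k, l_k)` of `-Δ_θ` on `S^{N-1}`, orthonormal in `L²(S^{N-1})`, where `k = 0`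
is the constant mode (eigenvalue `0`) and all later eigenvalues are positive. -/
structure IsSphericalHarmonics {N : ℕ} (ψ : ℕ → E N → ℝ) (l : ℕ → ℝ) : Prop where
  eigenpair : ∀ k, IsSphereEigenpair (ψ k) (l k)
  orthonormal : ∀ j k, ∫ θ, ψ j (θ : E N) * ψ k (θ : E N) ∂(sphereMeasure N)
    = if j = k then 1 else 0
  zero : l 0 = 0
  pos : ∀ k, 1 ≤ k → 0 < l k

/-- The space `X₁` over `B_R`: functions in `X` of the form
`φ(x) = ∑_{k ≥ 1} a_k(r) ψ_k(θ)`, `x = r θ`, with no `k = 0` mode; for each `r` the series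
converges in `L²(S^{N-1})`. -/
structure MemX1 (N : ℕ) (p : ℝ) (R : ℝ≥0∞) (φ : E N → ℝ) : Prop where
  memX : MemX N p R φ
  expansion : ∃ (ψ : ℕ → E N → ℝ) (l : ℕ → ℝ) (a : ℕ → ℝ → ℝ),
    IsSphericalHarmonics ψ l ∧
    ∀ r : ℝ, 0 < r → ENNReal.ofReal r < R →
      Filter.Tendsto
        (fun n : ℕ => ∫ θ, (φ (r • (θ : E N))
          - ∑ k ∈ Finset.Icc 1 n, a k r * ψ k (θ : E N)) ^ 2 ∂(sphereMeasure N))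
        Filter.atTop (nhds 0)

end SingularKernel

end

open scoped ENNReal ContDiff

noncomputable section

namespace SingularKernel

open Filter Topology MeasureTheory

/-! The solution is projected on an eigenfunction `ψ` with eigenvalue `l > 0`. With `a(r)` the
coefficient of `φ` along `ψ` on the sphere of radius `r`, testing the equation with `g(|x|)
ψ(x/|x|)` gives the radial equation `a'' = l a / r² + (c(r) - (N-1)) a' / r`, where `c(r) ≤ p/β`; it
holds classically because `a'` is continuous and its weak derivative is continuous
(`hasDerivAt_modeDeriv`).

A power `r^(-τ)` is a strict supersolution of this equation when `τ² - (N-2-c)τ - l < 0`. The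
spectral gap `l ≥ N-1` makes this true at `τ = σ` in the worst case `c = p/β`, hence also at `σ ± ε`
(`exists_exponent_gap`). The barrier `h = r^(-(σ+ε)) + r^(-(σ-ε))` dominates the bound `|a| ≤ C
r^(-σ)` both at `0` and at `∞`. So a positive value of `a/h` would force a positive interior
maximum, contradicting strictness (`radial_ode_nonpos`). The same applies to `-a`, so every mode
with `k ≥ 1` vanishes. Then `φ` on each sphere is orthogonal to the partial sums that converge to
it, and is zero.

The gap is proved without spherical harmonic theory. If `0 < l < N-1`, some `|x|^γ ψ(x/|x|)` with `0
< γ < 1` is harmonic off the origin. Its partial derivatives are harmonic and homogeneous of degree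
`γ-1`, between `-(N-2)` and `0`; a maximum principle kills them, and Euler's identity kills `ψ`
(`IsSphereEigenpair.eigenvalue_ge`). -/

/-! ### Laplacian of products and of radial functions -/

/-- The Laplacian as the sum of the iterated partial derivatives. -/
lemma laplacian_eq_sum_fderiv {N : ℕ} {f : E N → ℝ} {x : E N} (hf : ContDiffAt ℝ 2 f x) :
    Laplacian.laplacian f x = ∑ i, fderiv ℝ (fun y => fderiv ℝ f y
      (EuclideanSpace.basisFun (Fin N) ℝ i)) x (EuclideanSpace.basisFun (Fin N) ℝ i) := by
  rw [InnerProductSpace.laplacian_eq_iteratedFDeriv_orthonormalBasis f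
    (EuclideanSpace.basisFun (Fin N) ℝ)]
  refine Finset.sum_congr rfl fun i _ => ?_
  rw [iteratedFDeriv_two_apply]
  have hd : DifferentiableAt ℝ (fderiv ℝ f) x :=
    (hf.fderiv_right (m := 1) (by norm_num)).differentiableAt (by norm_num)
  rw [fderiv_clm_apply hd (differentiableAt_const _)]
  simp

lemma contDiffAt_fderiv_apply {N : ℕ} {f : E N → ℝ} {x : E N} {m n : ℕ∞ω} (hf : ContDiffAt ℝ n f x)
    (hmn : m + 1 ≤ n) (v : E N) : ContDiffAt ℝ m (fun y => fderiv ℝ f y v) x :=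
  (hf.fderiv_right hmn).clm_apply contDiffAt_const

lemma eventually_differentiableAt {N : ℕ} {f : E N → ℝ} {x : E N} (hf : ContDiffAt ℝ 2 f x) :
    ∀ᶠ y in 𝓝 x, DifferentiableAt ℝ f y := by
  filter_upwards [hf.eventually (by simp)] with y hy
  exact hy.differentiableAt (by norm_num)

lemma laplacian_mul {N : ℕ} {f g : E N → ℝ} {x : E N} (hf : ContDiffAt ℝ 2 f x)
    (hg : ContDiffAt ℝ 2 g x) :
    Laplacian.laplacian (fun y => f y * g y) x =
      f x * Laplacian.laplacian g x + g x * Laplacian.laplacian f x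
      + 2 * ∑ i, fderiv ℝ f x (EuclideanSpace.basisFun (Fin N) ℝ i) *
          fderiv ℝ g x (EuclideanSpace.basisFun (Fin N) ℝ i) := by
  rw [laplacian_eq_sum_fderiv hf, laplacian_eq_sum_fderiv hg,
    laplacian_eq_sum_fderiv (hf.mul hg), Finset.mul_sum, Finset.mul_sum, Finset.mul_sum,
    ← Finset.sum_add_distrib, ← Finset.sum_add_distrib]
  refine Finset.sum_congr rfl fun i _ => ?_
  set v := EuclideanSpace.basisFun (Fin N) ℝ i
  have h1 : (fun y => fderiv ℝ (fun y => f y * g y) y v) =ᶠ[𝓝 x]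
      fun y => f y * fderiv ℝ g y v + g y * fderiv ℝ f y v := by
    filter_upwards [eventually_differentiableAt hf, eventually_differentiableAt hg] with y h1 h2
    rw [fderiv_fun_mul h1 h2]
    simp
  have hf1 := hf.differentiableAt (by norm_num)
  have hg1 := hg.differentiableAt (by norm_num)
  have hf2 := (contDiffAt_fderiv_apply hf (m := 1) (by norm_num) v).differentiableAt (by norm_num)
  have hg2 := (contDiffAt_fderiv_apply hg (m := 1) (by norm_num) v).differentiableAt (by norm_num)
  rw [h1.fderiv_eq, fderiv_fun_add (hf1.fun_mul hg2) (hg1.fun_mul hf2), fderiv_fun_mul hf1 hg2,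
    fderiv_fun_mul hg1 hf2]
  simp only [add_apply, smul_apply, smul_eq_mul]
  ring

lemma hasFDerivAt_norm {N : ℕ} {x : E N} (hx : x ≠ 0) :
    HasFDerivAt (fun y : E N => ‖y‖) (‖x‖⁻¹ • innerSL ℝ x) x := by
  have h := ((hasStrictFDerivAt_norm_sq x).hasFDerivAt).sqrt (by positivity)
  have h' : (fun y : E N => √(‖y‖ ^ 2)) = fun y => ‖y‖ := by
    ext y; exact Real.sqrt_sq (norm_nonneg _)
  rw [h'] at h
  have h2 : (1 / (2 * √(‖x‖ ^ 2))) • 2 • (innerSL ℝ) x = ‖x‖⁻¹ • innerSL ℝ x := by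
    rw [Real.sqrt_sq (norm_nonneg x), ← Nat.cast_smul_eq_nsmul ℝ, smul_smul]
    congr 1
    have : ‖x‖ ≠ 0 := norm_ne_zero_iff.2 hx
    push_cast
    field_simp
  rwa [h2] at h

lemma fderiv_comp_norm_apply {N : ℕ} {g : ℝ → ℝ} {x : E N} (hx : x ≠ 0)
    (hg : DifferentiableAt ℝ g ‖x‖) (v : E N) :
    fderiv ℝ (fun y : E N => g ‖y‖) x v = deriv g ‖x‖ * (‖x‖⁻¹ * inner ℝ x v) := by
  have h := hg.hasDerivAt.comp_hasFDerivAt x (hasFDerivAt_norm hx)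
  have h2 : fderiv ℝ (fun y : E N => g ‖y‖) x = _ := h.fderiv
  rw [h2]
  simp

lemma sum_sq_inner_basisFun {N : ℕ} (x : E N) :
    ∑ i, (inner ℝ x (EuclideanSpace.basisFun (Fin N) ℝ i)) ^ 2 = ‖x‖ ^ 2 := by
  rw [EuclideanSpace.norm_sq_eq]
  refine Finset.sum_congr rfl fun i _ => ?_
  simp [EuclideanSpace.basisFun_apply, EuclideanSpace.inner_single_right]

lemma sum_inner_mul_apply_basisFun {N : ℕ} (x : E N) (L : E N →L[ℝ] ℝ) :
    ∑ i, inner ℝ x (EuclideanSpace.basisFun (Fin N) ℝ i) *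
      L (EuclideanSpace.basisFun (Fin N) ℝ i) = L x := by
  conv_rhs => rw [← (EuclideanSpace.basisFun (Fin N) ℝ).sum_repr' x, map_sum]
  refine Finset.sum_congr rfl fun i _ => ?_
  rw [map_smul, smul_eq_mul, real_inner_comm]

lemma laplacian_comp_norm {N : ℕ} {g : ℝ → ℝ} {x : E N} (hx : x ≠ 0)
    (hg : ContDiffAt ℝ 2 g ‖x‖) :
    Laplacian.laplacian (fun y : E N => g ‖y‖) x =
      deriv (deriv g) ‖x‖ + ((N : ℝ) - 1) * (deriv g ‖x‖ / ‖x‖) := by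
  have hx' : ‖x‖ ≠ 0 := norm_ne_zero_iff.2 hx
  rw [laplacian_eq_sum_fderiv (f := fun y : E N => g ‖y‖) (hg.comp x (contDiffAt_norm ℝ hx))]
  have hg' : DifferentiableAt ℝ (deriv g) ‖x‖ := by
    have h : deriv g = fun y => fderiv ℝ g y 1 := by ext y; simp
    rw [h]
    exact (((hg.fderiv_right (m := 1) (by norm_num)).clm_apply
      contDiffAt_const)).differentiableAt (by norm_num)
  have key : ∀ i, fderiv ℝ (fun y => fderiv ℝ (fun y : E N => g ‖y‖) y
      (EuclideanSpace.basisFun (Fin N) ℝ i)) x (EuclideanSpace.basisFun (Fin N) ℝ i) =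
      (deriv (deriv g) ‖x‖ / ‖x‖ ^ 2 - deriv g ‖x‖ / ‖x‖ ^ 3) *
        (inner ℝ x (EuclideanSpace.basisFun (Fin N) ℝ i)) ^ 2 + deriv g ‖x‖ / ‖x‖ := by
    intro i
    set v := EuclideanSpace.basisFun (Fin N) ℝ i with hv
    have hvv : ‖v‖ = 1 := by rw [hv, OrthonormalBasis.norm_eq_one]
    have h1 : (fun y => fderiv ℝ (fun y : E N => g ‖y‖) y v) =ᶠ[𝓝 x]
        fun y => deriv g ‖y‖ * (‖y‖⁻¹ * inner ℝ y v) := by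
      filter_upwards [(contDiffAt_norm ℝ hx (n := 2)).continuousAt.eventually
        (hg.eventually (by simp)), isOpen_ne.mem_nhds hx] with y h1 h2
      exact fderiv_comp_norm_apply h2 (h1.differentiableAt (by norm_num)) v
    rw [h1.fderiv_eq]
    have hn := hasFDerivAt_norm hx
    have d1 := hg'.hasDerivAt.comp_hasFDerivAt x hn
    have d2 := (hasDerivAt_inv hx').comp_hasFDerivAt x hn
    have d3 : HasFDerivAt (fun y : E N => inner ℝ y v) (innerSL ℝ v) x := by
      have := (innerSL ℝ v).hasFDerivAt (x := x)
      refine this.congr_of_eventuallyEq (Eventually.of_forall fun y => ?_)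
      simp [real_inner_comm]
    have := (d1.mul (d2.mul d3)).fderiv
    have h2 : fderiv ℝ (fun y : E N => deriv g ‖y‖ * (‖y‖⁻¹ * inner ℝ y v)) x = _ := this
    rw [h2]
    simp [hvv]
    field_simp
    ring
  rw [Finset.sum_congr rfl fun i _ => key i, Finset.sum_add_distrib, ← Finset.mul_sum,
    sum_sq_inner_basisFun]
  simp
  field_simp
  ring

/-- The gradient of `g(|x|)` is parallel to `x`, so the cross term of the product rule is a multiple
of the radial derivative of `u`, which vanishes. -/
lemma laplacian_norm_mul_of_radial_zero {N : ℕ} {g : ℝ → ℝ} {u : E N → ℝ} {x : E N} (hx : x ≠ 0)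
    (hg : ContDiffAt ℝ 2 g ‖x‖) (hu : ContDiffAt ℝ 2 u x) (hrad : fderiv ℝ u x x = 0) :
    Laplacian.laplacian (fun y : E N => g ‖y‖ * u y) x =
      g ‖x‖ * Laplacian.laplacian u x +
        u x * (deriv (deriv g) ‖x‖ + ((N : ℝ) - 1) * (deriv g ‖x‖ / ‖x‖)) := by
  rw [laplacian_mul (f := fun y : E N => g ‖y‖) (hg.comp x (contDiffAt_norm ℝ hx)) hu,
    laplacian_comp_norm hx hg]
  have : ∑ i, fderiv ℝ (fun y : E N => g ‖y‖) x (EuclideanSpace.basisFun (Fin N) ℝ i) *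
      fderiv ℝ u x (EuclideanSpace.basisFun (Fin N) ℝ i) = 0 := by
    have := sum_inner_mul_apply_basisFun x (fderiv ℝ u x)
    rw [hrad] at this
    calc _ = ∑ i, deriv g ‖x‖ * ‖x‖⁻¹ * (inner ℝ x (EuclideanSpace.basisFun (Fin N) ℝ i) *
      fderiv ℝ u x (EuclideanSpace.basisFun (Fin N) ℝ i)) := by
          refine Finset.sum_congr rfl fun i _ => ?_
          rw [fderiv_comp_norm_apply hx (hg.differentiableAt (by norm_num))]
          ring
      _ = 0 := by rw [← Finset.mul_sum, this, mul_zero]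
  rw [this]
  ring

/-! ### Positively homogeneous functions -/

/-- `f` is positively homogeneous of degree `μ` off the origin. -/
def IsPosHomogeneous {N : ℕ} (μ : ℝ) (f : E N → ℝ) : Prop :=
  ∀ c : ℝ, 0 < c → ∀ x : E N, x ≠ 0 → f (c • x) = c ^ μ * f x

lemma IsPosHomogeneous.fderiv_apply {N : ℕ} {μ : ℝ} {f : E N → ℝ} (hf : IsPosHomogeneous μ f)
    (v : E N) : IsPosHomogeneous (μ - 1) (fun x => fderiv ℝ f x v) := by
  intro c hc x hx
  have h1 : (fun y => f (c • y)) =ᶠ[𝓝 x] fun y => c ^ μ * f y := by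
    filter_upwards [isOpen_ne.mem_nhds hx] with y hy
    exact hf c hc y hy
  have h2 := h1.fderiv_eq (𝕜 := ℝ)
  rw [fderiv_comp_smul (𝕜 := ℝ) (f := f) (x := x) c] at h2
  have h3 : fderiv ℝ (fun y => c ^ μ * f y) x = c ^ μ • fderiv ℝ f x :=
    congrFun (fderiv_const_smul_field (𝕜 := ℝ) (f := f) (c ^ μ)) x
  rw [h3] at h2
  have h4 := congrArg (fun L : E N →L[ℝ] ℝ => L v) h2
  simp only [smul_apply, smul_eq_mul] at h4
  rw [Real.rpow_sub_one hc.ne']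
  field_simp
  linarith

/-- Euler's identity: differentiate `f (c • x) = c ^ μ * f x` in `c` at `c = 1`. -/
lemma IsPosHomogeneous.fderiv_self {N : ℕ} {μ : ℝ} {f : E N → ℝ} (hf : IsPosHomogeneous μ f)
    {x : E N} (hx : x ≠ 0) (hd : DifferentiableAt ℝ f x) : fderiv ℝ f x x = μ * f x := by
  have h1 : HasDerivAt (fun c : ℝ => f (c • x)) (fderiv ℝ f x x) 1 := by
    have h2 : HasDerivAt (fun c : ℝ => c • x) x 1 := by
      simpa using (hasDerivAt_id (1 : ℝ)).smul_const x
    have h3 : HasFDerivAt f (fderiv ℝ f x) ((1 : ℝ) • x) := by simpa using hd.hasFDerivAt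
    exact h3.comp_hasDerivAt 1 h2
  have h4 : HasDerivAt (fun c : ℝ => c ^ μ * f x) (μ * f x) 1 := by
    simpa using (Real.hasDerivAt_rpow_const (x := 1) (p := μ) (by simp)).mul_const (f x)
  have h5 : (fun c : ℝ => f (c • x)) =ᶠ[𝓝 1] fun c : ℝ => c ^ μ * f x := by
    filter_upwards [lt_mem_nhds one_pos] with c hc
    exact hf c hc x hx
  exact (h1.congr_of_eventuallyEq h5.symm).unique h4

lemma IsPosHomogeneous.laplacian {N : ℕ} {μ : ℝ} {f : E N → ℝ} (hf : IsPosHomogeneous μ f)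
    (hs : ∀ x : E N, x ≠ 0 → ContDiffAt ℝ 2 f x) :
    IsPosHomogeneous (μ - 2) (Laplacian.laplacian f) := by
  intro c hc x hx
  rw [laplacian_eq_sum_fderiv (hs x hx), laplacian_eq_sum_fderiv (hs _ (smul_ne_zero hc.ne' hx)),
    Finset.mul_sum]
  refine Finset.sum_congr rfl fun i _ => ?_
  have := ((hf.fderiv_apply (EuclideanSpace.basisFun (Fin N) ℝ i)).fderiv_apply
    (EuclideanSpace.basisFun (Fin N) ℝ i)) c hc x hx
  refine this.trans ?_
  congr 2
  ring

/-- Symmetry of second derivatives, used twice. It makes directional derivatives of harmonic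
functions harmonic. -/
lemma laplacian_fderiv_apply {N : ℕ} {f : E N → ℝ} {x : E N} (hf : ContDiffAt ℝ 3 f x) (v : E N) :
    Laplacian.laplacian (fun y => fderiv ℝ f y v) x =
      fderiv ℝ (Laplacian.laplacian f) x v := by
  have comm : ∀ {g : E N → ℝ} {y : E N}, ContDiffAt ℝ 2 g y → ∀ v w : E N,
      fderiv ℝ (fun z => fderiv ℝ g z v) y w = fderiv ℝ (fun z => fderiv ℝ g z w) y v := by
    intro g y hg v w
    have hd : DifferentiableAt ℝ (fderiv ℝ g) y :=
      (hg.fderiv_right (m := 1) (by norm_num)).differentiableAt (by norm_num)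
    rw [fderiv_clm_apply hd (differentiableAt_const _),
      fderiv_clm_apply hd (differentiableAt_const _)]
    have := (hg.isSymmSndFDerivAt (by simp)) v w
    simpa using this.symm
  have hev := hf.eventually (by simp)
  rw [laplacian_eq_sum_fderiv (contDiffAt_fderiv_apply hf (by norm_num) v)]
  have h1 : Laplacian.laplacian f =ᶠ[𝓝 x] fun y => ∑ i, fderiv ℝ (fun y => fderiv ℝ f y
      (EuclideanSpace.basisFun (Fin N) ℝ i)) y (EuclideanSpace.basisFun (Fin N) ℝ i) := by
    filter_upwards [hev] with y hy
    exact laplacian_eq_sum_fderiv (hy.of_le (by norm_num))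
  rw [h1.fderiv_eq, fderiv_fun_sum]
  · rw [sum_apply]
    refine Finset.sum_congr rfl fun i _ => ?_
    set w := EuclideanSpace.basisFun (Fin N) ℝ i
    have h2 : (fun y => fderiv ℝ (fun z => fderiv ℝ f z v) y w) =ᶠ[𝓝 x]
        fun y => fderiv ℝ (fun z => fderiv ℝ f z w) y v := by
      filter_upwards [hev] with y hy
      exact comm (hy.of_le (by norm_num)) v w
    rw [h2.fderiv_eq, comm (contDiffAt_fderiv_apply hf (by norm_num) w)]
  · intro i _
    exact (contDiffAt_fderiv_apply (contDiffAt_fderiv_apply hf (m := 2) (by norm_num) _)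
      (m := 1) (by norm_num) _).differentiableAt (by norm_num)

/-! ### Second-order conditions at a maximum, and a maximum principle for homogeneous functions -/

/-- A positive second derivative would make `x` a local minimum as well, so `f` would be locally
constant and the second derivative zero. -/
lemma deriv_deriv_nonpos_of_isLocalMax {f : ℝ → ℝ} {x : ℝ} (h : IsLocalMax f x)
    (hc : ContinuousAt f x) : deriv (deriv f) x ≤ 0 := by
  by_contra! hpos
  have hmin := isLocalMin_of_deriv_deriv_pos hpos h.deriv_eq_zero hc
  have hconst : f =ᶠ[𝓝 x] fun _ => f x := by
    filter_upwards [h, hmin] with y h1 h2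
    exact le_antisymm h1 h2
  have h2 : deriv f =ᶠ[𝓝 x] fun _ => 0 := by
    filter_upwards [hconst.eventuallyEq_nhds] with y hy
    rw [hy.deriv_eq]
    simp
  rw [h2.deriv_eq] at hpos
  simp at hpos

lemma laplacian_nonpos_of_isLocalMax {N : ℕ} {f : E N → ℝ} {x : E N} (hf : ContDiffAt ℝ 2 f x)
    (h : IsLocalMax f x) : Laplacian.laplacian f x ≤ 0 := by
  rw [laplacian_eq_sum_fderiv hf]
  refine Finset.sum_nonpos fun i _ => ?_
  set v := EuclideanSpace.basisFun (Fin N) ℝ i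
  have hline : ∀ s : ℝ, HasDerivAt (fun s : ℝ => x + s • v) v s := fun s => by
    simpa using ((hasDerivAt_id s).smul_const v).const_add x
  have ht : Tendsto (fun s : ℝ => x + s • v) (𝓝 0) (𝓝 x) := by
    simpa using (hline 0).continuousAt.tendsto
  have hmax : IsLocalMax (fun s : ℝ => f (x + s • v)) 0 := by
    have := ht.eventually h
    filter_upwards [this] with s hs
    simpa using hs
  have hd : deriv (fun s : ℝ => f (x + s • v)) =ᶠ[𝓝 0] fun s => fderiv ℝ f (x + s • v) v := by
    filter_upwards [ht.eventually (eventually_differentiableAt hf)] with s hs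
    exact (hs.hasFDerivAt.comp_hasDerivAt s (hline s)).deriv
  have h0 : x + (0 : ℝ) • v = x := by simp
  have hc : ContinuousAt (fun s : ℝ => f (x + s • v)) 0 :=
    ContinuousAt.comp (g := f) (by rw [h0]; exact hf.continuousAt) (hline 0).continuousAt
  have hkey := deriv_deriv_nonpos_of_isLocalMax hmax hc
  rw [hd.deriv_eq] at hkey
  have h2 : DifferentiableAt ℝ (fun y => fderiv ℝ f y v) (x + (0 : ℝ) • v) := by
    rw [h0]
    exact (contDiffAt_fderiv_apply hf (m := 1) (by norm_num) v).differentiableAt (by norm_num)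
  have h3 := (h2.hasFDerivAt.comp_hasDerivAt 0 (hline 0)).deriv
  rw [h0] at h3
  rw [← h3]
  exact hkey

lemma contDiffAt_rpow_const_pos {r μ : ℝ} (hr : 0 < r) {n : ℕ∞ω} :
    ContDiffAt ℝ n (fun s : ℝ => s ^ μ) r :=
  Real.contDiffAt_rpow_const_of_ne hr.ne'

lemma deriv_rpow_const_pos {r μ : ℝ} (hr : 0 < r) :
    deriv (fun s : ℝ => s ^ μ) r = μ * r ^ (μ - 1) :=
  (Real.hasDerivAt_rpow_const (Or.inl hr.ne')).deriv

lemma deriv_deriv_rpow_const_pos {r μ : ℝ} (hr : 0 < r) :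
    deriv (deriv fun s : ℝ => s ^ μ) r = μ * (μ - 1) * r ^ (μ - 2) := by
  have h : deriv (fun s : ℝ => s ^ μ) =ᶠ[𝓝 r] fun s => μ * s ^ (μ - 1) := by
    filter_upwards [lt_mem_nhds hr] with s hs
    exact deriv_rpow_const_pos hs
  rw [h.deriv_eq, ((Real.hasDerivAt_rpow_const (p := μ - 1) (Or.inl hr.ne')).const_mul μ).deriv]
  ring_nf

/-- A positively homogeneous harmonic function of degree strictly between `-(N-2)` and `0` is
nonpositive. -/
lemma IsPosHomogeneous.nonpos_of_laplacian_eq_zero {N : ℕ} {μ : ℝ} {h : E N → ℝ}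
    (hμ : -((N : ℝ) - 2) < μ) (hμ0 : μ < 0) (hh : IsPosHomogeneous μ h)
    (hs : ∀ x : E N, x ≠ 0 → ContDiffAt ℝ 2 h x)
    (hΔ : ∀ x : E N, x ≠ 0 → Laplacian.laplacian h x = 0) :
    ∀ x : E N, x ≠ 0 → h x ≤ 0 := by
  by_contra! hcon
  obtain ⟨z, hz, hzpos⟩ := hcon
  have hscale : ∀ y : E N, y ≠ 0 → h y = ‖y‖ ^ μ * h (‖y‖⁻¹ • y) := by
    intro y hy
    have hy' : 0 < ‖y‖ := norm_pos_iff.2 hy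
    rw [← hh ‖y‖ hy' (‖y‖⁻¹ • y) (smul_ne_zero (inv_ne_zero hy'.ne') hy), smul_smul,
      mul_inv_cancel₀ hy'.ne', one_smul]
  have hunit : ∀ y : E N, y ≠ 0 → ‖y‖⁻¹ • y ∈ Metric.sphere (0 : E N) 1 := by
    intro y hy
    simp [norm_smul, norm_ne_zero_iff.2 hy]
  have hne : ∀ y ∈ Metric.sphere (0 : E N) 1, y ≠ 0 := by
    rintro y hy rfl
    simp at hy
  obtain ⟨w, hw, hwmax⟩ := (isCompact_sphere (0 : E N) 1).exists_isMaxOn ⟨_, hunit z hz⟩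
    (f := h) fun y hy => (hs y (hne y hy)).continuousAt.continuousWithinAt
  have hw0 : w ≠ 0 := hne w hw
  have hw1 : ‖w‖ = 1 := by simpa using hw
  have hm : 0 < h w := by
    have h1 := hwmax (hunit z hz)
    have h2 := hscale z hz
    rw [h2] at hzpos
    exact (pos_of_mul_pos_right hzpos (by positivity)).trans_le h1
  -- By homogeneity the maximality of `w` on the sphere spreads to all rays: `h y ≤ h w * ‖y‖ ^ μ`,
  -- with equality at `w`.
  have hmax : IsLocalMax (fun y : E N => h y - h w * ‖y‖ ^ μ) w := by
    filter_upwards [isOpen_ne.mem_nhds hw0] with y hy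
    have h1 : h (‖y‖⁻¹ • y) ≤ h w := hwmax (hunit y hy)
    rw [hw1, hscale y hy]
    have : 0 ≤ ‖y‖ ^ μ := by positivity
    simp only [Real.one_rpow, mul_one, sub_self]
    nlinarith
  have hpow : ContDiffAt ℝ 2 (fun y : E N => ‖y‖ ^ μ) w :=
    ContDiffAt.comp (g := fun s : ℝ => s ^ μ) w
      (contDiffAt_rpow_const_pos (by rw [hw1]; norm_num)) (contDiffAt_norm ℝ hw0)
  have hsub : ContDiffAt ℝ 2 (fun y : E N => h w * ‖y‖ ^ μ) w := contDiffAt_const.mul hpow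
  have hle := laplacian_nonpos_of_isLocalMax ((hs w hw0).sub hsub) hmax
  have e1 : Laplacian.laplacian (fun y : E N => h y - h w * ‖y‖ ^ μ) w =
      Laplacian.laplacian h w - h w * Laplacian.laplacian (fun y : E N => ‖y‖ ^ μ) w := by
    have a1 := (hs w hw0).laplacian_sub hsub
    have a2 := InnerProductSpace.laplacian_smul (h w) hpow
    exact a1.trans (by rw [← smul_eq_mul (h w), ← a2]; rfl)
  have hone : (0 : ℝ) < ‖w‖ := by rw [hw1]; norm_num
  have e2 := laplacian_comp_norm (g := fun s : ℝ => s ^ μ) hw0 (contDiffAt_rpow_const_pos hone)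
  rw [e1, hΔ w hw0, e2, deriv_deriv_rpow_const_pos hone, deriv_rpow_const_pos hone, hw1] at hle
  simp only [Real.one_rpow] at hle
  -- The comparison function has Laplacian `h w * μ * (μ + N - 2) < 0` at `w`, so the difference has
  -- positive Laplacian at its local maximum.
  nlinarith [mul_pos hm (mul_pos_of_neg_of_neg hμ0 (by linarith : -(μ + ((N : ℝ) - 2)) < 0))]

/-! ### Spherical eigenfunctions and the spectral gap -/

lemma isPosHomogeneous_radialExt {N : ℕ} (ψ : E N → ℝ) : IsPosHomogeneous 0 (radialExt ψ) := by
  intro c hc x _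
  rw [Real.rpow_zero, one_mul]
  unfold radialExt
  congr 1
  rw [norm_smul, Real.norm_of_nonneg hc.le, mul_inv, mul_comm, mul_smul, smul_smul c⁻¹,
    inv_mul_cancel₀ hc.ne', one_smul]

lemma radialExt_of_norm_eq_one {N : ℕ} (ψ : E N → ℝ) {x : E N} (hx : ‖x‖ = 1) :
    radialExt ψ x = ψ x := by
  simp [radialExt, hx]

namespace IsSphereEigenpair

variable {N : ℕ} {ψ : E N → ℝ} {l : ℝ}

lemma contDiffAt (h : IsSphereEigenpair ψ l) {x : E N} (hx : x ≠ 0) :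
    ContDiffAt ℝ ∞ (radialExt ψ) x :=
  h.smooth.contDiffAt (isOpen_compl_singleton.mem_nhds hx)

lemma contDiffAt_two (h : IsSphereEigenpair ψ l) {x : E N} (hx : x ≠ 0) :
    ContDiffAt ℝ 2 (radialExt ψ) x :=
  (h.contDiffAt hx).of_le (WithTop.coe_le_coe.2 (le_top : (2 : ℕ∞) ≤ ⊤))

lemma fderiv_radial (h : IsSphereEigenpair ψ l) {x : E N} (hx : x ≠ 0) :
    fderiv ℝ (radialExt ψ) x x = 0 := by
  rw [(isPosHomogeneous_radialExt ψ).fderiv_self hx ((h.contDiffAt hx).differentiableAt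
    (by simp)), zero_mul]

/-- The Laplacian of a degree `0` function is homogeneous of degree `-2`, which carries the
eigenvalue identity from the unit sphere to every `x ≠ 0`. -/
lemma laplacian_radialExt (h : IsSphereEigenpair ψ l) {x : E N} (hx : x ≠ 0) :
    Laplacian.laplacian (radialExt ψ) x = -l * radialExt ψ x / ‖x‖ ^ 2 := by
  have hx' : 0 < ‖x‖ := norm_pos_iff.2 hx
  have hu : ‖‖x‖⁻¹ • x‖ = 1 := by simp [norm_smul, hx'.ne']
  have hu0 : ‖x‖⁻¹ • x ≠ 0 := smul_ne_zero (inv_ne_zero hx'.ne') hx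
  have h1 := (isPosHomogeneous_radialExt ψ).laplacian (fun y hy => h.contDiffAt_two hy)
    ‖x‖ hx' _ hu0
  have h2 := (isPosHomogeneous_radialExt ψ) ‖x‖ hx' _ hu0
  rw [smul_smul, mul_inv_cancel₀ hx'.ne', one_smul] at h1 h2
  rw [Real.rpow_zero, one_mul, radialExt_of_norm_eq_one ψ hu] at h2
  have h3 := h.eigen _ hu
  unfold sphereLaplacian at h3
  have h4 : ‖x‖ ^ (0 - 2 : ℝ) = (‖x‖ ^ 2)⁻¹ := by
    rw [zero_sub, Real.rpow_neg hx'.le]; norm_num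
  rw [h1, h2, h4, neg_mul, ← h3, neg_neg, div_eq_inv_mul]

lemma laplacian_mul_radialExt (h : IsSphereEigenpair ψ l) {g : ℝ → ℝ} {x : E N} (hx : x ≠ 0)
    (hg : ContDiffAt ℝ 2 g ‖x‖) :
    Laplacian.laplacian (fun y : E N => g ‖y‖ * radialExt ψ y) x =
      (deriv (deriv g) ‖x‖ + ((N : ℝ) - 1) * (deriv g ‖x‖ / ‖x‖) - l * g ‖x‖ / ‖x‖ ^ 2) *
        radialExt ψ x := by
  rw [laplacian_norm_mul_of_radial_zero hx hg (h.contDiffAt_two hx) (h.fderiv_radial hx),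
    h.laplacian_radialExt hx]
  ring

/-- The positive eigenvalues of `-Δ_θ` on `S^{N-1}` are at least `N - 1`. -/
theorem eigenvalue_ge (hN : 3 ≤ N) (h : IsSphereEigenpair ψ l) (hl : 0 < l) {θ : E N}
    (hθ : ‖θ‖ = 1) (hψ : ψ θ ≠ 0) : (N : ℝ) - 1 ≤ l := by
  by_contra! hlt
  have hN' : (3 : ℝ) ≤ N := by exact_mod_cast hN
  set n : ℝ := (N : ℝ) - 2 with hn
  -- `γ (γ + N - 2)` increases from `0` to `N - 1` on `[0, 1]`; the relation makes `|x|^γ ψ(x/|x|)`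
  -- harmonic.
  obtain ⟨γ, hγ0, hγ1, hγ⟩ : ∃ γ : ℝ, 0 < γ ∧ γ < 1 ∧ γ * (γ + n) = l := by
    have hc : ContinuousOn (fun γ : ℝ => γ * (γ + n)) (Set.Icc 0 1) := by fun_prop
    obtain ⟨γ, hγ, hγl⟩ := intermediate_value_Ioo zero_le_one hc
      (show l ∈ Set.Ioo _ _ from ⟨by simpa using hl, by linarith⟩)
    exact ⟨γ, hγ.1, hγ.2, hγl⟩
  set H : E N → ℝ := fun y => ‖y‖ ^ γ * radialExt ψ y with hH
  have hsm : ∀ x : E N, x ≠ 0 → ContDiffAt ℝ ∞ H x := fun x hx =>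
    (ContDiffAt.comp (g := fun s : ℝ => s ^ γ) x
      (contDiffAt_rpow_const_pos (norm_pos_iff.2 hx)) (contDiffAt_norm ℝ hx)).mul (h.contDiffAt hx)
  have hhom : IsPosHomogeneous γ H := by
    intro c hc x hx
    have := isPosHomogeneous_radialExt ψ c hc x hx
    simp only [hH, this, norm_smul, Real.norm_of_nonneg hc.le, Real.rpow_zero, one_mul,
      Real.mul_rpow hc.le (norm_nonneg x)]
    ring
  have hharm : ∀ x : E N, x ≠ 0 → Laplacian.laplacian H x = 0 := by
    intro x hx
    have hx' : 0 < ‖x‖ := norm_pos_iff.2 hx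
    rw [hH, h.laplacian_mul_radialExt (g := fun s : ℝ => s ^ γ) hx (contDiffAt_rpow_const_pos hx'),
      deriv_deriv_rpow_const_pos hx', deriv_rpow_const_pos hx', Real.rpow_sub hx',
      Real.rpow_sub hx', ← hγ, hn]
    norm_num
    left
    field_simp
    ring
  have hzero : ∀ v x : E N, x ≠ 0 → fderiv ℝ H x v = 0 := by
    have hle : ∀ v x : E N, x ≠ 0 → fderiv ℝ H x v ≤ 0 := by
      intro v
      -- The degree `γ - 1` lies in `(-1, 0)`, and `-(N - 2) ≤ -1` because `N ≥ 3`.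
      refine (hhom.fderiv_apply v).nonpos_of_laplacian_eq_zero (by linarith) (by linarith) ?_ ?_
      · exact fun x hx => contDiffAt_fderiv_apply (hsm x hx)
          (WithTop.coe_le_coe.2 (le_top : (2 + 1 : ℕ∞) ≤ ⊤)) v
      · intro x hx
        rw [laplacian_fderiv_apply ((hsm x hx).of_le
          (WithTop.coe_le_coe.2 (le_top : (3 : ℕ∞) ≤ ⊤))) v]
        have : Laplacian.laplacian H =ᶠ[𝓝 x] fun _ => 0 := by
          filter_upwards [isOpen_ne.mem_nhds hx] with y hy
          exact hharm y hy
        rw [this.fderiv_eq]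
        simp
    intro v x hx
    refine le_antisymm (hle v x hx) ?_
    have := hle (-v) x hx
    rw [map_neg] at this
    linarith
  have hθ0 : θ ≠ 0 := by
    rintro rfl
    simp at hθ
  have heuler := hhom.fderiv_self hθ0 ((hsm θ hθ0).differentiableAt (by simp))
  rw [hzero θ θ hθ0] at heuler
  simp only [hH, hθ, Real.one_rpow, one_mul, radialExt_of_norm_eq_one ψ hθ] at heuler
  exact hψ ((mul_eq_zero.1 heuler.symm).resolve_left hγ0.ne')

end IsSphereEigenpair

/-! ### Weak derivatives on an interval -/

lemma continuous_mul_of_tsupport_subset {X : Type*} [TopologicalSpace X] {K h : X → ℝ} {U : Set X}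
    (hU : IsOpen U) (hK : ContinuousOn K U) (hh : Continuous h) (hs : tsupport h ⊆ U) :
    Continuous fun x => K x * h x := by
  refine continuous_of_tsupport fun x hx => ?_
  have hx' : x ∈ U := hs (tsupport_mul_subset_right hx)
  exact (hK.continuousAt (hU.mem_nhds hx')).mul hh.continuousAt

lemma integrable_mul_of_tsupport_subset {X : Type*} [TopologicalSpace X] [MeasurableSpace X]
    [OpensMeasurableSpace X] {μ : Measure X} [IsFiniteMeasureOnCompacts μ]
    {K h : X → ℝ} {U : Set X} (hU : IsOpen U) (hK : ContinuousOn K U) (hh : Continuous h)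
    (hc : HasCompactSupport h) (hs : tsupport h ⊆ U) : Integrable (fun x => K x * h x) μ :=
  (continuous_mul_of_tsupport_subset hU hK hh hs).integrable_of_hasCompactSupport
    (hc.mul_left)

lemma continuousOn_of_hasDerivAt {A A' : ℝ → ℝ} {U : Set ℝ} (hA : ∀ r ∈ U, HasDerivAt A (A' r) r) :
    ContinuousOn A U := fun r hr => (hA r hr).continuousAt.continuousWithinAt

/-- Integration by parts against a compactly supported function, for a function that is only
differentiable on an open set containing the support. -/
lemma integral_mul_deriv_add_eq_zero {A A' g : ℝ → ℝ} {U : Set ℝ} (hU : IsOpen U)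
    (hA : ∀ r ∈ U, HasDerivAt A (A' r) r) (hA' : ContinuousOn A' U) (hg : ContDiff ℝ 1 g)
    (hc : HasCompactSupport g) (hs : tsupport g ⊆ U) :
    ∫ r, (A r * deriv g r + A' r * g r) = 0 := by
  have hAc := continuousOn_of_hasDerivAt hA
  have hg' : Continuous (deriv g) := hg.continuous_deriv (by norm_num)
  refine integral_eq_zero_of_hasDerivAt_of_integrable (f := fun r => A r * g r) (fun r => ?_)
    ((integrable_mul_of_tsupport_subset hU hAc hg' hc.deriv
      (tsupport_deriv_subset.trans hs)).add
      (integrable_mul_of_tsupport_subset hU hA' hg.continuous hc hs))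
    (integrable_mul_of_tsupport_subset hU hAc hg.continuous hc hs)
  by_cases hr : r ∈ tsupport g
  · rw [add_comm]
    exact (hA r (hs hr)).mul ((hg.differentiable (by norm_num)) r).hasDerivAt
  · have h0 : g =ᶠ[𝓝 r] 0 := notMem_tsupport_iff_eventuallyEq.1 hr
    have h1 : (fun r => A r * g r) =ᶠ[𝓝 r] fun _ => 0 := by
      filter_upwards [h0] with s hs
      simp [hs]
    have h2 : deriv g r = 0 := by rw [h0.deriv_eq]; simp
    rw [h2, image_eq_zero_of_notMem_tsupport hr]
    simpa using (hasDerivAt_const r (0 : ℝ)).congr_of_eventuallyEq h1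

/-- A test function with vanishing integral is the derivative of a test function. -/
lemma exists_testFunction_deriv_eq {k : ℝ → ℝ} {U : Set ℝ} (hU : U.OrdConnected)
    (hk : ContDiff ℝ ∞ k) (hc : HasCompactSupport k) (hs : tsupport k ⊆ U) (hint : ∫ r, k r = 0) :
    ∃ g : ℝ → ℝ, ContDiff ℝ ∞ g ∧ HasCompactSupport g ∧ tsupport g ⊆ U ∧ deriv g = k := by
  rcases (tsupport k).eq_empty_or_nonempty with he | hne
  · refine ⟨0, contDiff_const, HasCompactSupport.zero, by simp [tsupport], ?_⟩
    rw [tsupport_eq_empty_iff.1 he]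
    ext; simp
  obtain ⟨A, hA, hAmin⟩ := hc.exists_isLeast hne
  obtain ⟨B, hB, hBmax⟩ := hc.exists_isGreatest hne
  -- The base point `A - 1` is strictly left of the support, which therefore lies in the half-open
  -- interval `Set.Ioc (A - 1) r` once `r > B`.
  have hder : ∀ r, HasDerivAt (fun r => ∫ s in (A - 1)..r, k s) (k r) r := fun r =>
    intervalIntegral.integral_hasDerivAt_right (hk.continuous.intervalIntegrable _ _)
      (hk.continuous.stronglyMeasurableAtFilter _ _) hk.continuous.continuousAt
  have hderiv : deriv (fun r => ∫ s in (A - 1)..r, k s) = k := funext fun r => (hder r).deriv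
  have hsupp : Function.support (fun r => ∫ s in (A - 1)..r, k s) ⊆ Set.Icc A B := by
    intro r hr
    by_contra hcon
    apply hr
    rw [Set.mem_Icc, not_and_or, not_le, not_le] at hcon
    rcases hcon with h | h
    · refine intervalIntegral.integral_zero_ae (Eventually.of_forall fun s hs' => ?_)
      refine image_eq_zero_of_notMem_tsupport fun hs'' => ?_
      have := hAmin hs''
      rcases Set.mem_uIoc.1 hs' with h' | h' <;> linarith [h'.1, h'.2]
    · change ∫ s in (A - 1)..r, k s = 0
      rw [intervalIntegral.integral_eq_integral_of_support_subset, hint]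
      intro s hs'
      have hs'' := subset_tsupport k hs'
      exact ⟨by linarith [hAmin hs''], by linarith [hBmax hs'']⟩
  have hts : tsupport (fun r => ∫ s in (A - 1)..r, k s) ⊆ Set.Icc A B :=
    closure_minimal hsupp isClosed_Icc
  refine ⟨fun r => ∫ s in (A - 1)..r, k s, ?_, ?_, hts.trans (hU.out (hs hA) (hs hB)), hderiv⟩
  · rw [contDiff_infty_iff_deriv, hderiv]
    exact ⟨fun r => (hder r).differentiableAt, hk⟩
  · exact isCompact_Icc.of_isClosed_subset (isClosed_tsupport _) hts

/-- A continuous function whose weak derivative vanishes is constant. -/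
lemma exists_eq_const_of_integral_mul_deriv_eq_zero {K : ℝ → ℝ} {U : Set ℝ} (hU : IsOpen U)
    (hU' : U.OrdConnected) (hK : ContinuousOn K U)
    (h : ∀ g : ℝ → ℝ, ContDiff ℝ ∞ g → HasCompactSupport g → tsupport g ⊆ U →
      ∫ r, K r * deriv g r = 0) : ∃ c, ∀ r ∈ U, K r = c := by
  rcases U.eq_empty_or_nonempty with rfl | ⟨r₀, hr₀⟩
  · exact ⟨0, by simp⟩
  obtain ⟨δ, hδ, hball⟩ := Metric.isOpen_iff.1 hU r₀ hr₀
  let bump : ContDiffBump r₀ := ⟨δ / 4, δ / 2, by positivity, by linarith⟩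
  set ρ : ℝ → ℝ := bump.normed volume with hρ
  have hρd : ContDiff ℝ ∞ ρ := bump.contDiff_normed
  have hρc : HasCompactSupport ρ := bump.hasCompactSupport_normed
  have hρs : tsupport ρ ⊆ U := by
    rw [hρ, bump.tsupport_normed_eq]
    exact (Metric.closedBall_subset_ball (by change δ / 2 < δ; linarith)).trans hball
  have hρ1 : ∫ r, ρ r = 1 := bump.integral_normed
  set c : ℝ := ∫ r, K r * ρ r with hcdef
  refine ⟨c, ?_⟩
  have hae : ∀ᵐ r, r ∈ U → K r - c = 0 := by
    refine hU.ae_eq_zero_of_integral_contDiff_smul_eq_zero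
      ((hK.sub continuousOn_const).locallyIntegrableOn hU.measurableSet) ?_
    intro f hf hfc hfs
    -- Subtracting a multiple of the unit bump gives mean zero, so `k` is the derivative of a test
    -- function and may be paired with `K`.
    set k : ℝ → ℝ := fun r => f r - (∫ s, f s) * ρ r with hk
    have hfi : Integrable f := hf.continuous.integrable_of_hasCompactSupport hfc
    have hρi : Integrable ρ := hρd.continuous.integrable_of_hasCompactSupport hρc
    have hkd : ContDiff ℝ ∞ k := hf.sub (contDiff_const.mul hρd)
    have hsub : tsupport k ⊆ tsupport f ∪ tsupport ρ := by
      refine closure_minimal (fun r hr => ?_) ((isClosed_tsupport _).union (isClosed_tsupport _))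
      by_contra hcon
      rw [Set.mem_union, not_or] at hcon
      apply hr
      simp [hk, image_eq_zero_of_notMem_tsupport hcon.1, image_eq_zero_of_notMem_tsupport hcon.2]
    obtain ⟨g, hg, hgc, hgs, hgk⟩ := exists_testFunction_deriv_eq hU' hkd
      ((hfc.isCompact.union hρc.isCompact).of_isClosed_subset (isClosed_tsupport _) hsub)
      (hsub.trans (Set.union_subset hfs hρs))
      (by rw [hk, integral_sub hfi (hρi.const_mul _), integral_const_mul, hρ1]; ring)
    have h0 := h g hg hgc hgs
    rw [hgk] at h0
    have i1 : Integrable fun r => K r * f r :=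
      integrable_mul_of_tsupport_subset hU hK hf.continuous hfc hfs
    have i2 : Integrable fun r => K r * ρ r :=
      integrable_mul_of_tsupport_subset hU hK hρd.continuous hρc hρs
    have e1 : ∫ r, K r * k r = (∫ r, K r * f r) - (∫ s, f s) * c := by
      rw [hcdef, ← integral_const_mul, ← integral_sub i1 (i2.const_mul _)]
      congr 1
      ext r
      simp only [hk]
      ring
    have e2 : ∫ r, f r • (K r - c) = (∫ r, K r * f r) - (∫ s, f s) * c := by
      rw [← integral_mul_const, ← integral_sub i1 (hfi.mul_const _)]
      congr 1
      ext r
      simp only [smul_eq_mul]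
      ring
    rw [e2, ← e1, h0]
  have hEq : Set.EqOn (fun r => K r - c) (fun _ => 0) U := by
    refine Measure.eqOn_open_of_ae_eq (μ := volume) ?_ hU (hK.sub continuousOn_const)
      continuousOn_const
    rw [Filter.EventuallyEq, ae_restrict_iff' hU.measurableSet]
    exact hae
  intro r hr
  have := hEq hr
  simp only at this
  linarith

/-- A continuous function with continuous weak derivative is continuously differentiable. -/
lemma hasDerivAt_of_weak_deriv {P F : ℝ → ℝ} {U : Set ℝ} (hU : IsOpen U)
    (hU' : U.OrdConnected) (hP : ContinuousOn P U) (hF : ContinuousOn F U)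
    (h : ∀ g : ℝ → ℝ, ContDiff ℝ ∞ g → HasCompactSupport g → tsupport g ⊆ U →
      ∫ r, (P r * deriv g r + F r * g r) = 0) : ∀ r ∈ U, HasDerivAt P (F r) r := by
  intro r₀ hr₀
  -- `P` minus this primitive of `F` has zero weak derivative, hence is constant.
  set Φ : ℝ → ℝ := fun r => ∫ s in r₀..r, F s with hΦ
  have hΦd : ∀ r ∈ U, HasDerivAt Φ (F r) r := fun r hr =>
    intervalIntegral.integral_hasDerivAt_right
      ((hF.mono (hU'.uIcc_subset hr₀ hr)).intervalIntegrable)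
      (hF.stronglyMeasurableAtFilter hU r hr) (hF.continuousAt (hU.mem_nhds hr))
  have hΦc := continuousOn_of_hasDerivAt hΦd
  obtain ⟨c, hc⟩ := exists_eq_const_of_integral_mul_deriv_eq_zero (K := fun r => P r - Φ r) hU hU'
    (hP.sub hΦc) (by
      intro g hg hgc hgs
      have hg1 : ContDiff ℝ 1 g := hg.of_le (WithTop.coe_le_coe.2 (le_top : (1 : ℕ∞) ≤ ⊤))
      have h1 := h g hg hgc hgs
      have h2 := integral_mul_deriv_add_eq_zero hU hΦd hF hg1 hgc hgs
      have hg' : Continuous (deriv g) := hg1.continuous_deriv (by norm_num)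
      have hs' := (tsupport_deriv_subset (f := g)).trans hgs
      have i1 := integrable_mul_of_tsupport_subset (μ := volume) hU hP hg' hgc.deriv hs'
      have i2 := integrable_mul_of_tsupport_subset (μ := volume) hU hΦc hg' hgc.deriv hs'
      have i3 := integrable_mul_of_tsupport_subset (μ := volume) hU hF hg.continuous hgc hgs
      rw [integral_add i1 i3] at h1
      rw [integral_add i2 i3] at h2
      simp only [sub_mul]
      rw [integral_sub i1 i2]
      linarith)
  have hev : P =ᶠ[𝓝 r₀] fun r => Φ r + c := by
    filter_upwards [hU.mem_nhds hr₀] with r hr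
    linarith [hc r hr]
  exact ((hΦd r₀ hr₀).add_const c).congr_of_eventuallyEq hev

/-! ### Comparison principle for the radial equation -/

/-- The radii of the punctured ball `B_R \ {0}`. -/
def radii (R : ℝ≥0∞) : Set ℝ := {r | 0 < r ∧ ENNReal.ofReal r < R}

/-- The radii of the punctured closed ball. -/
def closedRadii (R : ℝ≥0∞) : Set ℝ := {r | 0 < r ∧ ENNReal.ofReal r ≤ R}

lemma isOpen_radii (R : ℝ≥0∞) : IsOpen (radii R) :=
  isOpen_Ioi.inter (isOpen_Iio.preimage ENNReal.continuous_ofReal)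

lemma ordConnected_radii (R : ℝ≥0∞) : (radii R).OrdConnected := by
  refine ⟨fun x hx y hy z hz => ⟨hx.1.trans_le hz.1, ?_⟩⟩
  exact (ENNReal.ofReal_le_ofReal hz.2).trans_lt hy.2

lemma radii_subset_closedRadii (R : ℝ≥0∞) : radii R ⊆ closedRadii R := fun _ h => ⟨h.1, h.2.le⟩

/-- Keeping the exponent `-τ` and dividing by `r` leaves a single real power, so later identities
reduce to field arithmetic. -/
lemma hasDerivAt_rpow_neg {r τ : ℝ} (hr : 0 < r) :
    HasDerivAt (fun s : ℝ => s ^ (-τ)) (-τ * r ^ (-τ) / r) r := by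
  convert Real.hasDerivAt_rpow_const (p := -τ) (Or.inl hr.ne') using 1
  rw [Real.rpow_sub_one hr.ne']
  ring

lemma hasDerivAt_rpow_neg_div {r τ : ℝ} (hr : 0 < r) :
    HasDerivAt (fun s : ℝ => -τ * s ^ (-τ) / s) (τ * (τ + 1) * r ^ (-τ) / r ^ 2) r := by
  have h := ((hasDerivAt_rpow_neg (τ := τ) hr).const_mul (-τ)).div (hasDerivAt_id r) hr.ne'
  refine (h.congr_deriv ?_).congr_of_eventuallyEq (Eventually.of_forall fun s => ?_)
  · simp only [id]
    field_simp
    ring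
  · simp

/-- Hypotheses `hq₁`, `hq₂` say that `r^(-(σ+ε))` and `r^(-(σ-ε))` are strict supersolutions. Their
sum outgrows `r^(-σ)` at both ends, so a positive supremum of `a/h` is attained inside and violates
strictness. -/
lemma radial_ode_nonpos {R : ℝ≥0∞} {a b c : ℝ → ℝ} {n l σ ε C : ℝ} (hε : 0 < ε)
    (ha : ∀ r ∈ radii R, HasDerivAt a (b r) r)
    (hb : ∀ r ∈ radii R, HasDerivAt b (l * a r / r ^ 2 + (c r - n) * b r / r) r)
    (hac : ContinuousOn a (closedRadii R)) (ha0 : ∀ r ∈ closedRadii R, r ∉ radii R → a r = 0)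
    (hC : ∀ r ∈ radii R, a r ≤ C * r ^ (-σ))
    (hq₁ : ∀ r ∈ radii R, (σ + ε) ^ 2 - (n - 1 - c r) * (σ + ε) - l < 0)
    (hq₂ : ∀ r ∈ radii R, (σ - ε) ^ 2 - (n - 1 - c r) * (σ - ε) - l < 0) :
    ∀ r ∈ radii R, a r ≤ 0 := by
  by_contra! hcon
  obtain ⟨r₁, hr₁, hpos⟩ := hcon
  set h : ℝ → ℝ := fun r => r ^ (-(σ + ε)) + r ^ (-(σ - ε)) with hh
  have hhpos : ∀ r, 0 < r → 0 < h r := fun r hr => by positivity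
  set m₀ := a r₁ / h r₁ with hm₀
  have hm₀pos : 0 < m₀ := div_pos hpos (hhpos r₁ hr₁.1)
  obtain ⟨M, hM⟩ := ((tendsto_rpow_atTop hε).eventually_gt_atTop (C / m₀)).exists_forall_of_atTop
  have hr₁0 : 0 < r₁ := hr₁.1
  -- `[B⁻¹, B]` contains `r₁`, and outside it `r^(-ε) + r^ε > C / m₀`, so the ratio `a/h` stays
  -- below its value `m₀` at `r₁`.
  set B := max M (max r₁ r₁⁻¹) with hBdef
  have hB0 : 0 < B := hr₁0.trans_le ((le_max_left _ _).trans (le_max_right _ _))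
  have hB₁ : r₁ ≤ B := (le_max_left _ _).trans (le_max_right _ _)
  have hB₂ : B⁻¹ ≤ r₁ := inv_le_of_inv_le₀ hr₁0 ((le_max_right _ _).trans (le_max_right _ _))
  have hsplit : ∀ r, 0 < r → h r = r ^ (-σ) * (r ^ (-ε) + r ^ ε) := by
    intro r hr
    rw [mul_add, ← Real.rpow_add hr, ← Real.rpow_add hr]
    simp only [hh]
    ring_nf
  have hout : ∀ r ∈ radii R, r ∉ Set.Icc B⁻¹ B → a r < m₀ * h r := by
    intro r hr hrB
    have hr0 : 0 < r := hr.1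
    have h1 : C / m₀ < r ^ (-ε) + r ^ ε := by
      have p1 : 0 < r ^ (-ε) := by positivity
      have p2 : 0 < r ^ ε := by positivity
      rw [Set.mem_Icc, not_and_or, not_le, not_le] at hrB
      rcases hrB with h' | h'
      · have h2 := hM r⁻¹ ((le_max_left _ _).trans (le_inv_of_le_inv₀ hr0 h'.le))
        rw [Real.inv_rpow hr0.le, ← Real.rpow_neg hr0.le] at h2
        linarith
      · have h2 := hM r ((le_max_left _ _).trans h'.le)
        linarith
    rw [div_lt_iff₀ hm₀pos] at h1
    have hp : 0 < r ^ (-σ) := by positivity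
    calc a r ≤ C * r ^ (-σ) := hC r hr
      _ < (r ^ (-ε) + r ^ ε) * m₀ * r ^ (-σ) := by gcongr
      _ = m₀ * h r := by rw [hsplit r hr0]; ring
  -- The endpoint `R`, if it lies in the window, is included for compactness; `a` vanishes there, so
  -- the maximum is not attained there.
  set K := Set.Icc B⁻¹ B ∩ {r | ENNReal.ofReal r ≤ R} with hK
  have hKc : IsCompact K :=
    isCompact_Icc.inter_right (isClosed_Iic.preimage ENNReal.continuous_ofReal)
  have hKpos : ∀ r ∈ K, 0 < r := fun r hr => (inv_pos.2 hB0).trans_le hr.1.1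
  have hKR : K ⊆ closedRadii R := fun r hr => ⟨hKpos r hr, hr.2⟩
  have hhc : ContinuousOn h K := fun r hr => by
    have := hKpos r hr
    exact ((hasDerivAt_rpow_neg this).add (hasDerivAt_rpow_neg this)).continuousAt.continuousWithinAt
  obtain ⟨r₀, hr₀K, hmax⟩ := hKc.exists_isMaxOn ⟨r₁, ⟨hB₂, hB₁⟩, hr₁.2.le⟩
    ((hac.mono hKR).div hhc fun r hr => (hhpos r (hKpos r hr)).ne')
  set m := a r₀ / h r₀ with hm
  have hm₀m : m₀ ≤ m := hmax (⟨⟨hB₂, hB₁⟩, hr₁.2.le⟩ : r₁ ∈ K)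
  have hr₀ : r₀ ∈ radii R := by
    by_contra hnot
    rw [hm, ha0 r₀ (hKR hr₀K) hnot, zero_div] at hm₀m
    linarith
  have hr₀0 : 0 < r₀ := hr₀.1
  have ham : a r₀ = m * h r₀ := by rw [hm, div_mul_cancel₀ _ (hhpos r₀ hr₀0).ne']
  have hle : ∀ r ∈ radii R, a r ≤ m * h r := by
    intro r hr
    by_cases hrB : r ∈ Set.Icc B⁻¹ B
    · have : a r / h r ≤ m := hmax (⟨hrB, hr.2.le⟩ : r ∈ K)
      rwa [div_le_iff₀ (hhpos r hr.1)] at this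
    · have := hout r hr hrB
      have := mul_le_mul_of_nonneg_right hm₀m (hhpos r hr.1).le
      linarith
  set h' : ℝ → ℝ := fun r => -(σ + ε) * r ^ (-(σ + ε)) / r + -(σ - ε) * r ^ (-(σ - ε)) / r with hh'
  have hhd : ∀ r, 0 < r → HasDerivAt h (h' r) r := fun r hr =>
    (hasDerivAt_rpow_neg hr).add (hasDerivAt_rpow_neg hr)
  have hhdd : HasDerivAt h' ((σ + ε) * (σ + ε + 1) * r₀ ^ (-(σ + ε)) / r₀ ^ 2 +
      (σ - ε) * (σ - ε + 1) * r₀ ^ (-(σ - ε)) / r₀ ^ 2) r₀ :=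
    (hasDerivAt_rpow_neg_div hr₀0).add (hasDerivAt_rpow_neg_div hr₀0)
  have hvd : ∀ r ∈ radii R, HasDerivAt (fun r => a r - m * h r) (b r - m * h' r) r := fun r hr =>
    (ha r hr).sub ((hhd r hr.1).const_mul m)
  have hloc : IsLocalMax (fun r => a r - m * h r) r₀ := by
    filter_upwards [(isOpen_radii R).mem_nhds hr₀] with r hr
    rw [ham, sub_self]
    linarith [hle r hr]
  -- `a - m h` has maximum zero at `r₀`, so `a = m h` and `a' = m h'` there; with the equation for
  -- `b'` this turns `a'' - m h'' ≤ 0` into a statement about `h` alone.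
  have hb0 : b r₀ = m * h' r₀ := by linarith [hloc.hasDerivAt_eq_zero (hvd r₀ hr₀)]
  have hdd := deriv_deriv_nonpos_of_isLocalMax hloc (hvd r₀ hr₀).continuousAt
  have hev : deriv (fun r => a r - m * h r) =ᶠ[𝓝 r₀] fun r => b r - m * h' r := by
    filter_upwards [(isOpen_radii R).mem_nhds hr₀] with r hr
    exact (hvd r hr).deriv
  rw [hev.deriv_eq, ((hb r₀ hr₀).fun_sub (hhdd.const_mul m)).deriv, ham, hb0] at hdd
  have key : l * (m * h r₀) / r₀ ^ 2 + (c r₀ - n) * (m * h' r₀) / r₀ -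
      m * ((σ + ε) * (σ + ε + 1) * r₀ ^ (-(σ + ε)) / r₀ ^ 2 +
        (σ - ε) * (σ - ε + 1) * r₀ ^ (-(σ - ε)) / r₀ ^ 2) =
      m / r₀ ^ 2 * (-((σ + ε) ^ 2 - (n - 1 - c r₀) * (σ + ε) - l) * r₀ ^ (-(σ + ε)) +
        -((σ - ε) ^ 2 - (n - 1 - c r₀) * (σ - ε) - l) * r₀ ^ (-(σ - ε))) := by
    simp only [hh, hh']
    field_simp
    ring
  rw [key] at hdd
  have hpos' : 0 < m / r₀ ^ 2 * (-((σ + ε) ^ 2 - (n - 1 - c r₀) * (σ + ε) - l) * r₀ ^ (-(σ + ε)) +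
        -((σ - ε) ^ 2 - (n - 1 - c r₀) * (σ - ε) - l) * r₀ ^ (-(σ - ε))) := by
    have hmpos : 0 < m := hm₀pos.trans_le hm₀m
    have q1 := neg_pos.2 (hq₁ r₀ hr₀)
    have q2 := neg_pos.2 (hq₂ r₀ hr₀)
    positivity
  linarith

/-! ### Polar coordinates and integrals over spheres -/

instance (N : ℕ) : IsFiniteMeasure (sphereMeasure N) := by
  unfold sphereMeasure; infer_instance

instance (N : ℕ) : (sphereMeasure N).IsOpenPosMeasure := by
  unfold sphereMeasure; infer_instance

/-- Integration in polar coordinates. -/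
lemma integral_eq_integral_sphere {N : ℕ} (hN : 1 ≤ N) {F : E N → ℝ} (hF : Integrable F) :
    ∫ x, F x = ∫ r in Set.Ioi (0 : ℝ), r ^ (N - 1) *
      ∫ θ, F (r • (θ : E N)) ∂(sphereMeasure N) := by
  have : Nontrivial (E N) := by
    have : Nonempty (Fin N) := ⟨⟨0, hN⟩⟩
    infer_instance
  have hdim : Module.finrank ℝ (E N) = N := finrank_euclideanSpace_fin
  set ν := Measure.volumeIoiPow (N - 1)
  have hmp : MeasurePreserving (homeomorphUnitSphereProd (E N))
      ((volume : Measure (E N)).comap (↑)) ((sphereMeasure N).prod ν) := by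
    have := (volume : Measure (E N)).measurePreserving_homeomorphUnitSphereProd
    rwa [hdim] at this
  set f : (Metric.sphere (0 : E N) 1) × Set.Ioi (0 : ℝ) → ℝ := fun z => F ((z.2 : ℝ) • (z.1 : E N))
  have hcomp : ∀ x : ({0}ᶜ : Set (E N)), f (homeomorphUnitSphereProd (E N) x) = F x := by
    intro x
    have hx : ‖(x : E N)‖ ≠ 0 := norm_ne_zero_iff.2 x.2
    simp only [f]
    congr 1
    simp [smul_smul, hx]
  have h1 : ∫ x, F x = ∫ x : ({0}ᶜ : Set (E N)), F x ∂((volume : Measure (E N)).comap (↑)) := by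
    rw [integral_subtype_comap (measurableSet_singleton _).compl F, restrict_compl_singleton]
  have h2 : ∫ x : ({0}ᶜ : Set (E N)), F x ∂((volume : Measure (E N)).comap (↑)) =
      ∫ z, f z ∂((sphereMeasure N).prod ν) := by
    rw [← hmp.integral_comp (Homeomorph.measurableEmbedding _) f]
    exact integral_congr_ae (Eventually.of_forall fun x => (hcomp x).symm)
  have hfi : Integrable f ((sphereMeasure N).prod ν) := by
    rw [← hmp.integrable_comp_emb (Homeomorph.measurableEmbedding _)]
    have : (f ∘ homeomorphUnitSphereProd (E N)) = fun x : ({0}ᶜ : Set (E N)) => F x :=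
      funext hcomp
    rw [this]
    exact (integrableOn_iff_comap_subtypeVal (measurableSet_singleton _).compl).1 hF.integrableOn
  rw [h1, h2, integral_prod_symm f hfi]
  simp only [ν, Measure.volumeIoiPow]
  rw [integral_withDensity_eq_integral_toReal_smul (by fun_prop) (by simp),
    integral_subtype_comap measurableSet_Ioi fun r : ℝ => (ENNReal.ofReal (r ^ (N - 1))).toReal •
      ∫ θ, F (r • (θ : E N)) ∂(sphereMeasure N)]
  refine setIntegral_congr_fun measurableSet_Ioi fun r hr => ?_
  simp only [smul_eq_mul]
  rw [ENNReal.toReal_ofReal (pow_nonneg (le_of_lt hr) _)]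

lemma isOpen_puncturedBall (N : ℕ) (R : ℝ≥0∞) : IsOpen (puncturedBall N R) :=
  isOpen_ne.inter (isOpen_Iio.preimage continuous_enorm)

lemma norm_coe_sphere {N : ℕ} (θ : Metric.sphere (0 : E N) 1) : ‖(θ : E N)‖ = 1 := by
  simp

lemma norm_smul_sphere {N : ℕ} {r : ℝ} (hr : 0 < r) (θ : Metric.sphere (0 : E N) 1) :
    ‖r • (θ : E N)‖ = r := by
  rw [norm_smul, norm_coe_sphere, mul_one, Real.norm_of_nonneg hr.le]

lemma enorm_smul_sphere {N : ℕ} {r : ℝ} (hr : 0 < r) (θ : Metric.sphere (0 : E N) 1) :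
    ‖r • (θ : E N)‖ₑ = ENNReal.ofReal r := by
  rw [← ofReal_norm, norm_smul_sphere hr]

lemma smul_sphere_ne_zero {N : ℕ} {r : ℝ} (hr : 0 < r) (θ : Metric.sphere (0 : E N) 1) :
    r • (θ : E N) ≠ 0 := by
  rw [← norm_ne_zero_iff, norm_smul_sphere hr]
  exact hr.ne'

lemma smul_mem_puncturedBall {N : ℕ} {R : ℝ≥0∞} {r : ℝ} (hr : r ∈ radii R)
    (θ : Metric.sphere (0 : E N) 1) : r • (θ : E N) ∈ puncturedBall N R :=
  ⟨smul_sphere_ne_zero hr.1 θ, by rw [enorm_smul_sphere hr.1]; exact hr.2⟩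

lemma smul_mem_puncturedClosedBall {N : ℕ} {R : ℝ≥0∞} {r : ℝ} (hr : r ∈ closedRadii R)
    (θ : Metric.sphere (0 : E N) 1) : r • (θ : E N) ∈ puncturedClosedBall N R :=
  ⟨smul_sphere_ne_zero hr.1 θ, by rw [enorm_smul_sphere hr.1]; exact hr.2⟩

lemma norm_mem_radii {N : ℕ} {R : ℝ≥0∞} {x : E N} : ‖x‖ ∈ radii R ↔ x ∈ puncturedBall N R := by
  simp only [radii, puncturedBall, Set.mem_ofPred_eq, norm_pos_iff, ofReal_norm]

lemma IsSphereEigenpair.continuous_sphere {N : ℕ} {ψ : E N → ℝ} {l : ℝ}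
    (h : IsSphereEigenpair ψ l) :
    Continuous fun θ : Metric.sphere (0 : E N) 1 => ψ (θ : E N) := by
  have h1 : (fun θ : Metric.sphere (0 : E N) 1 => ψ (θ : E N)) =
      fun θ : Metric.sphere (0 : E N) 1 => radialExt ψ (θ : E N) :=
    funext fun θ => (radialExt_of_norm_eq_one ψ (norm_coe_sphere θ)).symm
  rw [h1]
  refine h.smooth.continuousOn.comp_continuous continuous_subtype_val fun θ => ?_
  have := norm_coe_sphere θ
  rintro (h0 : (θ : E N) = 0)
  simp [h0] at this

lemma integrable_sphere {N : ℕ} {f : Metric.sphere (0 : E N) 1 → ℝ} (hf : Continuous f) :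
    Integrable f (sphereMeasure N) :=
  hf.integrable_of_hasCompactSupport (HasCompactSupport.of_compactSpace f)

/-- Local closedness makes the subtype locally compact, as the theorem on parametric integrals
needs; it covers both `radii R` and `closedRadii R`. -/
lemma continuousOn_integral_sphere {N : ℕ} {T : Set ℝ} (hT : IsLocallyClosed T)
    {f : ℝ → Metric.sphere (0 : E N) 1 → ℝ} (hf : ContinuousOn f.uncurry (T ×ˢ Set.univ)) :
    ContinuousOn (fun r => ∫ θ, f r θ ∂(sphereMeasure N)) T := by
  have := hT.locallyCompactSpace
  rw [continuousOn_iff_continuous_domRestrict]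
  have h1 : Continuous (Function.uncurry fun (r : T) θ => f r θ) :=
    hf.comp_continuous (f := fun z : T × Metric.sphere (0 : E N) 1 => ((z.1 : ℝ), z.2))
      (by fun_prop) fun z => ⟨z.1.2, trivial⟩
  simpa using! continuous_parametric_integral_of_continuous (μ := sphereMeasure N) h1
    isCompact_univ

/-! ### Regularity and growth of the modes -/

/-- The coefficient of `φ` along `ψ` on the sphere of radius `r`. -/
def modeCoeff {N : ℕ} (φ ψ : E N → ℝ) (r : ℝ) : ℝ :=
  ∫ θ, φ (r • (θ : E N)) * ψ (θ : E N) ∂(sphereMeasure N)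

/-- The coefficient of the radial derivative of `φ` along `ψ` on the sphere of radius `r`. -/
def modeDeriv {N : ℕ} (φ ψ : E N → ℝ) (r : ℝ) : ℝ :=
  ∫ θ, fderiv ℝ φ (r • (θ : E N)) (θ : E N) * ψ (θ : E N) ∂(sphereMeasure N)

lemma isLocallyClosed_closedRadii (R : ℝ≥0∞) : IsLocallyClosed (closedRadii R) :=
  isOpen_Ioi.isLocallyClosed.inter
    (isClosed_Iic.preimage ENNReal.continuous_ofReal).isLocallyClosed

section Mode

variable {N : ℕ} {p : ℝ} {R : ℝ≥0∞} {φ ψ : E N → ℝ} {l : ℝ}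

lemma MemX.continuousOn_uncurry (hφ : MemX N p R φ) (hψ : IsSphereEigenpair ψ l) :
    ContinuousOn (Function.uncurry fun (r : ℝ) (θ : Metric.sphere (0 : E N) 1) =>
      φ (r • (θ : E N)) * ψ (θ : E N)) (closedRadii R ×ˢ Set.univ) :=
  (hφ.continuousOn.comp (f := fun z : ℝ × Metric.sphere (0 : E N) 1 => z.1 • (z.2 : E N))
    (by fun_prop) fun z hz => smul_mem_puncturedClosedBall hz.1 z.2).mul
    (hψ.continuous_sphere.comp continuous_snd).continuousOn

lemma MemX.continuousOn_fderiv (hφ : MemX N p R φ) :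
    ContinuousOn (fderiv ℝ φ) (puncturedBall N R) :=
  hφ.contDiffOn.continuousOn_fderiv_of_isOpen (isOpen_puncturedBall N R) (by norm_num)

lemma MemX.continuousOn_uncurry_fderiv (hφ : MemX N p R φ) (hψ : IsSphereEigenpair ψ l) :
    ContinuousOn (Function.uncurry fun (r : ℝ) (θ : Metric.sphere (0 : E N) 1) =>
      fderiv ℝ φ (r • (θ : E N)) (θ : E N) * ψ (θ : E N)) (radii R ×ˢ Set.univ) :=
  ((hφ.continuousOn_fderiv.comp
    (f := fun z : ℝ × Metric.sphere (0 : E N) 1 => z.1 • (z.2 : E N))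
    (by fun_prop) fun z hz => smul_mem_puncturedBall hz.1 z.2).clm_apply
      (by fun_prop : Continuous fun z : ℝ × Metric.sphere (0 : E N) 1 =>
        (z.2 : E N)).continuousOn).mul
    (hψ.continuous_sphere.comp continuous_snd).continuousOn

lemma MemX.continuous_sphere (hφ : MemX N p R φ) {r : ℝ} (hr : r ∈ closedRadii R) :
    Continuous fun θ : Metric.sphere (0 : E N) 1 => φ (r • (θ : E N)) :=
  hφ.continuousOn.comp_continuous (by fun_prop) fun θ => smul_mem_puncturedClosedBall hr θ

lemma MemX.continuous_sphere_fderiv (hφ : MemX N p R φ) {r : ℝ} (hr : r ∈ radii R) :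
    Continuous fun θ : Metric.sphere (0 : E N) 1 => fderiv ℝ φ (r • (θ : E N)) (θ : E N) :=
  (hφ.continuousOn_fderiv.comp_continuous (by fun_prop)
    fun θ => smul_mem_puncturedBall hr θ).clm_apply continuous_subtype_val

lemma MemX.continuousOn_modeCoeff (hφ : MemX N p R φ) (hψ : IsSphereEigenpair ψ l) :
    ContinuousOn (modeCoeff φ ψ) (closedRadii R) :=
  continuousOn_integral_sphere (isLocallyClosed_closedRadii R) (hφ.continuousOn_uncurry hψ)

lemma MemX.continuousOn_modeDeriv (hφ : MemX N p R φ) (hψ : IsSphereEigenpair ψ l) :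
    ContinuousOn (modeDeriv φ ψ) (radii R) :=
  continuousOn_integral_sphere (isOpen_radii R).isLocallyClosed (hφ.continuousOn_uncurry_fderiv hψ)

/-- Differentiation under the integral; the integrand's derivative is bounded on a compact band of
radii times the sphere. -/
lemma MemX.hasDerivAt_modeCoeff (hφ : MemX N p R φ) (hψ : IsSphereEigenpair ψ l) {r : ℝ}
    (hr : r ∈ radii R) : HasDerivAt (modeCoeff φ ψ) (modeDeriv φ ψ r) r := by
  obtain ⟨δ, hδ, hball⟩ := Metric.nhds_basis_closedBall.mem_iff.1 ((isOpen_radii R).mem_nhds hr)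
  obtain ⟨C, hC⟩ := ((isCompact_closedBall r δ).prod
    (isCompact_univ (X := Metric.sphere (0 : E N) 1))).exists_bound_of_continuousOn
    ((hφ.continuousOn_uncurry_fderiv hψ).mono (Set.prod_mono hball le_rfl))
  refine (hasDerivAt_integral_of_dominated_loc_of_deriv_le (𝕜 := ℝ) (μ := sphereMeasure N)
    (F := fun (s : ℝ) (θ : Metric.sphere (0 : E N) 1) => φ (s • (θ : E N)) * ψ (θ : E N))
    (F' := fun (s : ℝ) (θ : Metric.sphere (0 : E N) 1) =>
      fderiv ℝ φ (s • (θ : E N)) (θ : E N) * ψ (θ : E N)) (x₀ := r) (bound := fun _ => C)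
    (s := Metric.closedBall r δ) (Metric.closedBall_mem_nhds r hδ) ?_ ?_ ?_ ?_ ?_ ?_).2
  · filter_upwards [(isOpen_radii R).mem_nhds hr] with s hs
    exact ((hφ.continuous_sphere (radii_subset_closedRadii R hs)).mul
      hψ.continuous_sphere).aestronglyMeasurable
  · exact integrable_sphere ((hφ.continuous_sphere (radii_subset_closedRadii R hr)).mul
      hψ.continuous_sphere)
  · exact ((hφ.continuous_sphere_fderiv hr).mul hψ.continuous_sphere).aestronglyMeasurable
  · exact Eventually.of_forall fun θ s hs => hC (s, θ) ⟨hs, trivial⟩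
  · exact integrable_const _
  · refine Eventually.of_forall fun θ s hs => ?_
    have h1 : HasDerivAt (fun s : ℝ => s • (θ : E N)) (θ : E N) s := by
      simpa using (hasDerivAt_id s).smul_const (θ : E N)
    have h2 : DifferentiableAt ℝ φ (s • (θ : E N)) :=
      (hφ.contDiffOn.contDiffAt ((isOpen_puncturedBall N R).mem_nhds
        (smul_mem_puncturedBall (hball hs) θ))).differentiableAt (by norm_num)
    exact (h2.hasFDerivAt.comp_hasDerivAt s h1).mul_const _

lemma MemX.modeCoeff_boundary (hφ : MemX N p R φ) {r : ℝ} (hr : r ∈ closedRadii R)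
    (hr' : r ∉ radii R) : modeCoeff φ ψ r = 0 := by
  have hrR : ENNReal.ofReal r = R := le_antisymm hr.2 (not_lt.1 fun h => hr' ⟨hr.1, h⟩)
  unfold modeCoeff
  simp [hφ.boundary _ ((enorm_smul_sphere hr.1 _).trans hrR)]

lemma MemX.exists_abs_modeCoeff_le (hφ : MemX N p R φ) (hψ : IsSphereEigenpair ψ l) :
    ∃ C, ∀ r ∈ radii R, |modeCoeff φ ψ r| ≤ C * r ^ (-sigma p) := by
  obtain ⟨C, hC⟩ := hφ.bounded
  obtain ⟨D, hD⟩ := (isCompact_univ (X := Metric.sphere (0 : E N) 1)).exists_bound_of_continuousOn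
    hψ.continuous_sphere.continuousOn
  refine ⟨C * D * (sphereMeasure N).real Set.univ, fun r hr => ?_⟩
  have hr0 : 0 < r := hr.1
  have hbound : ∀ θ : Metric.sphere (0 : E N) 1,
      ‖φ (r • (θ : E N)) * ψ (θ : E N)‖ ≤ C * r ^ (-sigma p) * D := by
    intro θ
    have h1 := hC _ (smul_mem_puncturedBall hr θ)
    rw [norm_smul_sphere hr0] at h1
    have h2 : 0 ≤ r ^ (sigma p + 1) * ‖fderiv ℝ φ (r • (θ : E N))‖ := by positivity
    have h3 : |φ (r • (θ : E N))| ≤ C * r ^ (-sigma p) := by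
      rw [Real.rpow_neg hr0.le, ← div_eq_mul_inv, le_div_iff₀ (by positivity)]
      linarith
    rw [norm_mul]
    exact mul_le_mul h3 (hD θ trivial) (norm_nonneg _) ((abs_nonneg _).trans h3)
  have := norm_integral_le_of_norm_le_const (μ := sphereMeasure N)
    (Eventually.of_forall hbound)
  refine this.trans (le_of_eq ?_)
  ring

end Mode

/-! ### The drift coefficient and the equation of a mode -/

/-- The drift coefficient as a function of the radius. -/
def radialDrift (N : ℕ) (p : ℝ) (t : ℝ≥0∞) (r : ℝ) : ℝ :=
  if t = ⊤ then 0 else p / (beta N p * r ^ 2 + t.toReal * r ^ (alpha N p + 1))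

lemma driftCoeff_eq_radialDrift (N : ℕ) (p : ℝ) (t : ℝ≥0∞) (x : E N) :
    driftCoeff N p t x = radialDrift N p t ‖x‖ := rfl

lemma continuousOn_radialDrift {N : ℕ} {p : ℝ} {t : ℝ≥0∞} (hβ : 0 < beta N p) :
    ContinuousOn (radialDrift N p t) (Set.Ioi 0) := by
  unfold radialDrift
  split_ifs with ht
  · exact continuousOn_const
  · refine continuousOn_const.div ?_ fun r hr => ?_
    · refine (continuousOn_const.mul (continuousOn_pow 2)).add (continuousOn_const.mul ?_)
      exact fun r hr => (Real.continuousAt_rpow_const r _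
        (Or.inl (ne_of_gt hr))).continuousWithinAt
    · have hr' : 0 < r := hr
      have : 0 ≤ t.toReal * r ^ (alpha N p + 1) := by positivity
      have : 0 < beta N p * r ^ 2 := by positivity
      linarith

/-- The term in `t` only enlarges the denominator; dropping it leaves the worst case `p / β`,
uniform in `t` and `r`. -/
lemma radialDrift_mul_sq_le {N : ℕ} {p : ℝ} {t : ℝ≥0∞} (hβ : 0 < beta N p) (hp : 0 < p) {r : ℝ}
    (hr : 0 < r) : radialDrift N p t r * r ^ 2 ≤ p / beta N p := by
  unfold radialDrift
  split_ifs with ht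
  · rw [zero_mul]; positivity
  · have h1 : 0 ≤ t.toReal * r ^ (alpha N p + 1) := by positivity
    have h2 : 0 < beta N p * r ^ 2 := by positivity
    rw [div_mul_eq_mul_div, div_le_div_iff₀ (by linarith) hβ]
    nlinarith [mul_nonneg hp.le h1]

/-- The lower bound on `p` says exactly that `α > 1`. -/
lemma beta_pos {N : ℕ} {p : ℝ} (hN : 3 ≤ N) (hp : (N : ℝ) / ((N : ℝ) - 1) < p) :
    0 < beta N p := by
  have hN' : (3 : ℝ) ≤ N := by exact_mod_cast hN
  rw [div_lt_iff₀ (by linarith)] at hp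
  have h1 : 0 < alpha N p - 1 := by
    unfold alpha
    linarith
  have h2 : 0 < p - 1 := by
    unfold alpha at h1
    by_contra! h
    nlinarith
  exact div_pos h2 h1

lemma laplacian_eq_zero_of_notMem_tsupport {N : ℕ} {η : E N → ℝ} {x : E N} (hx : x ∉ tsupport η) :
    Laplacian.laplacian η x = 0 := by
  have h := notMem_tsupport_iff_eventuallyEq.1 hx
  rw [(InnerProductSpace.laplacian_congr_nhds h).self_of_nhds]
  exact congrFun (InnerProductSpace.laplacian_const (c := (0 : ℝ))) x

lemma tsupport_laplacian_subset {N : ℕ} (η : E N → ℝ) :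
    tsupport (Laplacian.laplacian η) ⊆ tsupport η := by
  refine closure_minimal (fun x hx => ?_) (isClosed_tsupport _)
  by_contra h
  exact hx (laplacian_eq_zero_of_notMem_tsupport h)

lemma continuous_laplacian {N : ℕ} {η : E N → ℝ} (hη : ContDiff ℝ ∞ η) :
    Continuous (Laplacian.laplacian η) := by
  have h2 : ContDiff ℝ 2 η := hη.of_le (WithTop.coe_le_coe.2 (le_top : (2 : ℕ∞) ≤ ⊤))
  have : Laplacian.laplacian η = fun x => ∑ i, fderiv ℝ (fun y => fderiv ℝ η y
      (EuclideanSpace.basisFun (Fin N) ℝ i)) x (EuclideanSpace.basisFun (Fin N) ℝ i) :=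
    funext fun x => laplacian_eq_sum_fderiv h2.contDiffAt
  rw [this]
  refine continuous_finsetSum _ fun i _ => ?_
  have h1 : ContDiff ℝ 1 fun y => fderiv ℝ η y (EuclideanSpace.basisFun (Fin N) ℝ i) :=
    (h2.fderiv_right (by norm_num)).clm_apply contDiff_const
  exact (h1.continuous_fderiv (by norm_num)).clm_apply continuous_const

section Mode

variable {N : ℕ} {p : ℝ} {t R : ℝ≥0∞} {φ ψ : E N → ℝ} {l : ℝ}

/-- Separated test functions. -/
lemma IsSphereEigenpair.testFunction (hψ : IsSphereEigenpair ψ l) {g : ℝ → ℝ}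
    (hg : ContDiff ℝ ∞ g) (hgc : HasCompactSupport g) (hgs : tsupport g ⊆ radii R) :
    ContDiff ℝ ∞ (fun x : E N => g ‖x‖ * radialExt ψ x) ∧
      HasCompactSupport (fun x : E N => g ‖x‖ * radialExt ψ x) ∧
      tsupport (fun x : E N => g ‖x‖ * radialExt ψ x) ⊆ puncturedBall N R := by
  have hsub : tsupport (fun x : E N => g ‖x‖ * radialExt ψ x) ⊆ norm ⁻¹' tsupport g := by
    refine closure_minimal (fun x hx => ?_) ((isClosed_tsupport g).preimage continuous_norm)
    refine subset_tsupport g fun h => hx ?_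
    simp [h]
  refine ⟨contDiff_iff_contDiffAt.2 fun x => ?_, ?_, fun x hx => norm_mem_radii.1 (hgs (hsub hx))⟩
  · by_cases hx : x = 0
    · have h0 : x ∉ tsupport fun x : E N => g ‖x‖ * radialExt ψ x := fun h => by
        have := (hgs (hsub h)).1
        simp [hx] at this
      exact contDiffAt_const.congr_of_eventuallyEq (notMem_tsupport_iff_eventuallyEq.1 h0)
    · exact (hg.contDiffAt.comp x (contDiffAt_norm ℝ hx)).mul (hψ.contDiffAt hx)
  · obtain ⟨M, hM⟩ := hgc.isCompact.isBounded.subset_closedBall 0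
    refine (isCompact_closedBall (0 : E N) M).of_isClosed_subset (isClosed_tsupport _) ?_
    intro x hx
    have := hM (hsub hx)
    simpa using this

lemma integral_sphere_separated (hφ : MemX N p R φ) (hψ : IsSphereEigenpair ψ l) {g : ℝ → ℝ}
    (hg : ContDiff ℝ ∞ g) {r : ℝ} (hr : r ∈ radii R) :
    ∫ θ, (-(φ (r • (θ : E N)) * Laplacian.laplacian (fun x : E N => g ‖x‖ * radialExt ψ x)
        (r • (θ : E N))) + driftCoeff N p t (r • (θ : E N)) *
        fderiv ℝ φ (r • (θ : E N)) (r • (θ : E N)) *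
          (g ‖r • (θ : E N)‖ * radialExt ψ (r • (θ : E N)))) ∂(sphereMeasure N) =
      -((deriv (deriv g) r + ((N : ℝ) - 1) * (deriv g r / r) - l * g r / r ^ 2) *
        modeCoeff φ ψ r) + radialDrift N p t r * r * g r * modeDeriv φ ψ r := by
  have hg2 : ContDiff ℝ 2 g := hg.of_le (WithTop.coe_le_coe.2 (le_top : (2 : ℕ∞) ≤ ⊤))
  have hpt : ∀ θ : Metric.sphere (0 : E N) 1,
      -(φ (r • (θ : E N)) * Laplacian.laplacian (fun x : E N => g ‖x‖ * radialExt ψ x)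
        (r • (θ : E N))) + driftCoeff N p t (r • (θ : E N)) *
        fderiv ℝ φ (r • (θ : E N)) (r • (θ : E N)) *
          (g ‖r • (θ : E N)‖ * radialExt ψ (r • (θ : E N))) =
      -(deriv (deriv g) r + ((N : ℝ) - 1) * (deriv g r / r) - l * g r / r ^ 2) *
        (φ (r • (θ : E N)) * ψ (θ : E N)) + radialDrift N p t r * r * g r *
        (fderiv ℝ φ (r • (θ : E N)) (θ : E N) * ψ (θ : E N)) := by
    intro θ
    have hθ0 : (θ : E N) ≠ 0 := by simpa using smul_sphere_ne_zero one_pos θ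
    have hu : radialExt ψ (r • (θ : E N)) = ψ (θ : E N) := by
      rw [isPosHomogeneous_radialExt ψ r hr.1 _ hθ0, Real.rpow_zero, one_mul,
        radialExt_of_norm_eq_one ψ (norm_coe_sphere θ)]
    rw [hψ.laplacian_mul_radialExt (smul_sphere_ne_zero hr.1 θ) hg2.contDiffAt,
      driftCoeff_eq_radialDrift, norm_smul_sphere hr.1, hu, map_smul, smul_eq_mul]
    ring
  rw [integral_congr_ae (Eventually.of_forall hpt), integral_add, integral_const_mul,
    integral_const_mul]
  · simp only [modeCoeff, modeDeriv]
    ring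
  · exact (integrable_sphere ((hφ.continuous_sphere (radii_subset_closedRadii R hr)).mul
      hψ.continuous_sphere)).const_mul _
  · exact (integrable_sphere ((hφ.continuous_sphere_fderiv hr).mul
      hψ.continuous_sphere)).const_mul _

/-- Test the distributional equation with `g(|x|) ψ(x/|x|)` and integrate in polar coordinates; the
angular integral produces the mode and its radial derivative. -/
lemma weak_mode_equation (hN : 1 ≤ N) (hβ : 0 < beta N p) (hφ : MemX N p R φ)
    (hL : SolvesLt N p t R φ) (hψ : IsSphereEigenpair ψ l) {g : ℝ → ℝ}
    (hg : ContDiff ℝ ∞ g) (hgc : HasCompactSupport g) (hgs : tsupport g ⊆ radii R) :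
    ∫ r in Set.Ioi (0 : ℝ), r ^ (N - 1) *
      (-((deriv (deriv g) r + ((N : ℝ) - 1) * (deriv g r / r) - l * g r / r ^ 2) *
        modeCoeff φ ψ r) + radialDrift N p t r * r * g r * modeDeriv φ ψ r) = 0 := by
  obtain ⟨hη, hηc, hηs⟩ := hψ.testFunction hg hgc hgs
  have h0 := hL _ hη hηc hηs
  have hint : Integrable fun x : E N =>
      -(φ x * Laplacian.laplacian (fun x : E N => g ‖x‖ * radialExt ψ x) x) +
        driftCoeff N p t x * fderiv ℝ φ x x * (g ‖x‖ * radialExt ψ x) := by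
    refine Integrable.add (Integrable.neg ?_) ?_
    · exact integrable_mul_of_tsupport_subset (isOpen_puncturedBall N R) hφ.contDiffOn.continuousOn
        (continuous_laplacian hη)
        (hηc.isCompact.of_isClosed_subset (isClosed_tsupport _) (tsupport_laplacian_subset _))
        ((tsupport_laplacian_subset _).trans hηs)
    · refine integrable_mul_of_tsupport_subset (isOpen_puncturedBall N R)
        (ContinuousOn.mul ?_ (hφ.continuousOn_fderiv.clm_apply continuousOn_id))
        hη.continuous hηc hηs
      exact (continuousOn_radialDrift (t := t) hβ).comp (f := fun x : E N => ‖x‖)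
        continuous_norm.continuousOn fun x hx => norm_pos_iff.2 hx.1
  rw [integral_eq_integral_sphere hN hint] at h0
  refine Eq.trans (setIntegral_congr_fun measurableSet_Ioi fun r hr => ?_) h0
  congr 1
  by_cases hrR : r ∈ radii R
  · exact (integral_sphere_separated hφ hψ hg hrR).symm
  · have hnot : r ∉ tsupport g := fun h => hrR (hgs h)
    have e1 : g r = 0 := image_eq_zero_of_notMem_tsupport hnot
    have e2 : deriv g r = 0 :=
      image_eq_zero_of_notMem_tsupport fun h => hnot (tsupport_deriv_subset h)
    have e3 : deriv (deriv g) r = 0 := image_eq_zero_of_notMem_tsupport fun h =>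
      hnot (tsupport_deriv_subset (tsupport_deriv_subset h))
    have hball : ∀ θ : Metric.sphere (0 : E N) 1, r • (θ : E N) ∉
        tsupport fun x : E N => g ‖x‖ * radialExt ψ x := by
      intro θ h
      have := norm_mem_radii.2 (hηs h)
      rw [norm_smul_sphere hr] at this
      exact hrR this
    have e4 : ∀ θ : Metric.sphere (0 : E N) 1,
        Laplacian.laplacian (fun x : E N => g ‖x‖ * radialExt ψ x) (r • (θ : E N)) = 0 :=
      fun θ => laplacian_eq_zero_of_notMem_tsupport (hball θ)
    simp [e1, e2, e3, e4, norm_smul_sphere (show 0 < r from hr)]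

lemma hasDerivAt_pow_pred (hN : 2 ≤ N) {r : ℝ} (hr : r ≠ 0) :
    HasDerivAt (fun s : ℝ => s ^ (N - 1)) (((N : ℝ) - 1) * r ^ (N - 1) / r) r := by
  obtain ⟨M, rfl⟩ := Nat.exists_eq_add_of_le' hN
  refine (hasDerivAt_pow (M + 2 - 1) r).congr_deriv ?_
  rw [show M + 2 - 1 = M + 1 by omega, Nat.add_sub_cancel]
  push_cast
  field_simp
  ring

/-- The modes of a distributional solution are classical solutions of the radial equation. -/
lemma hasDerivAt_modeDeriv (hN : 2 ≤ N) (hβ : 0 < beta N p) (hφ : MemX N p R φ)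
    (hL : SolvesLt N p t R φ) (hψ : IsSphereEigenpair ψ l) :
    ∀ r ∈ radii R, HasDerivAt (modeDeriv φ ψ) (l * modeCoeff φ ψ r / r ^ 2 +
      (radialDrift N p t r * r ^ 2 - ((N : ℝ) - 1)) * modeDeriv φ ψ r / r) r := by
  set a := modeCoeff φ ψ with ha
  set b := modeDeriv φ ψ with hb
  set d := radialDrift N p t with hd
  have hU := isOpen_radii R
  have hne : ∀ r ∈ radii R, r ≠ 0 := fun r hr => ne_of_gt hr.1
  have hac : ContinuousOn a (radii R) :=
    (hφ.continuousOn_modeCoeff hψ).mono (radii_subset_closedRadii R)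
  have hbc : ContinuousOn b (radii R) := hφ.continuousOn_modeDeriv hψ
  have hdc : ContinuousOn d (radii R) := (continuousOn_radialDrift hβ).mono fun r hr => hr.1
  have hw : Continuous fun r : ℝ => r ^ (N - 1) := continuous_pow _
  have hPc : ContinuousOn (fun r => r ^ (N - 1) * b r) (radii R) := hw.continuousOn.mul hbc
  have hFc : ContinuousOn (fun r => r ^ (N - 1) * (l * a r / r ^ 2 + d r * r * b r)) (radii R) :=
    hw.continuousOn.mul (((continuousOn_const.mul hac).div (continuousOn_pow 2)
      fun r hr => pow_ne_zero 2 (hne r hr)).add ((hdc.mul continuousOn_id).mul hbc))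
  -- Divergence form of the radial equation: the weight `r^(N-1)` absorbs the term `(N-1) a' / r`.
  have hweak : ∀ r ∈ radii R, HasDerivAt (fun r => r ^ (N - 1) * b r)
      (r ^ (N - 1) * (l * a r / r ^ 2 + d r * r * b r)) r := by
    refine hasDerivAt_of_weak_deriv hU (ordConnected_radii R) hPc hFc ?_
    intro g hg hgc hgs
    have hg' : ContDiff ℝ ∞ (deriv g) := (contDiff_infty_iff_deriv.1 hg).2
    have hgs' : tsupport (deriv g) ⊆ radii R := tsupport_deriv_subset.trans hgs
    -- Since `k' = r^(N-1) (g'' + (N-1) g' / r)`, the second-order part of the weak equation is `∫ a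
    -- k'`, and one integration by parts moves it to `-∫ b k`.
    set k : ℝ → ℝ := fun r => r ^ (N - 1) * deriv g r with hk
    have hkd : ContDiff ℝ 1 k := (contDiff_id.pow _).mul
      (hg'.of_le (WithTop.coe_le_coe.2 (le_top : (1 : ℕ∞) ≤ ⊤)))
    have hkc : HasCompactSupport k := hgc.deriv.mul_left
    have hks : tsupport k ⊆ radii R := tsupport_mul_subset_right.trans hgs'
    have i1 := integral_mul_deriv_add_eq_zero hU (fun r hr => hφ.hasDerivAt_modeCoeff hψ hr) hbc
      hkd hkc hks
    have hk' : ∀ r, 0 < r → deriv k r = r ^ (N - 1) * deriv (deriv g) r +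
        ((N : ℝ) - 1) * r ^ (N - 1) / r * deriv g r := by
      intro r hr
      have := (hasDerivAt_pow_pred hN hr.ne').mul
        ((hg'.differentiable (by simp)) r).hasDerivAt
      rw [show deriv k r = _ from this.deriv]
      ring
    have i2 := weak_mode_equation (by omega) hβ hφ hL hψ hg hgc hgs
    have i3 : ∫ r, (-(a r * deriv k r) +
        r ^ (N - 1) * (l * a r / r ^ 2 + d r * r * b r) * g r) = 0 := by
      rw [← i2, ← setIntegral_eq_integral_of_forall_compl_eq_zero (s := Set.Ioi (0 : ℝ))]
      · refine setIntegral_congr_fun measurableSet_Ioi fun r hr => ?_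
        have hr0 : r ≠ 0 := ne_of_gt hr
        simp only [hk' r hr]
        field_simp
        ring
      · intro r hr
        have hnot : r ∉ radii R := fun h => hr h.1
        have e1 : g r = 0 := image_eq_zero_of_notMem_tsupport fun h => hnot (hgs h)
        have e2 : deriv k r = 0 := image_eq_zero_of_notMem_tsupport fun h =>
          hnot (hks (tsupport_deriv_subset h))
        simp [e1, e2]
    have hk'c : Continuous (deriv k) := hkd.continuous_deriv (by norm_num)
    have j1 : Integrable fun r => a r * deriv k r := integrable_mul_of_tsupport_subset hU hac hk'c
      hkc.deriv (tsupport_deriv_subset.trans hks)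
    have j2 : Integrable fun r => b r * k r :=
      integrable_mul_of_tsupport_subset hU hbc hkd.continuous hkc hks
    have j3 : Integrable fun r => r ^ (N - 1) * (l * a r / r ^ 2 + d r * r * b r) * g r :=
      integrable_mul_of_tsupport_subset hU hFc hg.continuous hgc hgs
    have hsum := integral_add (j1.add j2) (j1.neg.add j3)
    simp only [Pi.add_apply, Pi.neg_apply] at hsum
    rw [i1, i3, add_zero] at hsum
    rw [← hsum]
    congr 1
    ext r
    simp only [hk]
    ring
  intro r hr
  have hr0 := hne r hr
  have hw0 : r ^ (N - 1) ≠ 0 := pow_ne_zero _ hr0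
  have hq := (hweak r hr).div (hasDerivAt_pow_pred hN hr0) hw0
  have hev : b =ᶠ[𝓝 r] ((fun r => r ^ (N - 1) * b r) / fun s : ℝ => s ^ (N - 1)) := by
    filter_upwards [hU.mem_nhds hr] with s hs
    have := pow_ne_zero (N - 1) (hne s hs)
    simp only [Pi.div_apply]
    field_simp
  refine (hq.congr_of_eventuallyEq hev).congr_deriv ?_
  field_simp
  ring

end Mode

/-! ### Admissible exponents and vanishing of the modes -/

/-- The inequality holds strictly at `σ`, so continuity allows a perturbation `±ε`. Positivity of `σ
- ε` is needed to pass from `p / β` to smaller drifts. -/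
lemma exists_exponent_gap {N : ℕ} {p l : ℝ} (hN : 3 ≤ N) (hp : (N : ℝ) / ((N : ℝ) - 1) < p)
    (hp2 : p < 2) (hl : (N : ℝ) - 1 ≤ l) :
    ∃ ε, 0 < ε ∧ 0 < sigma p - ε ∧
      (sigma p + ε) ^ 2 - ((N : ℝ) - 1 - 1 - p / beta N p) * (sigma p + ε) - l < 0 ∧
      (sigma p - ε) ^ 2 - ((N : ℝ) - 1 - 1 - p / beta N p) * (sigma p - ε) - l < 0 := by
  have hN' : (3 : ℝ) ≤ N := by exact_mod_cast hN
  have hβ := beta_pos hN hp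
  set n : ℝ := (N : ℝ) - 1 with hn
  have hp1 : 1 < p := by
    refine lt_trans ?_ hp
    rw [lt_div_iff₀ (by linarith)]
    linarith
  have hq0 : 0 < p - 1 := by linarith
  have hα : 0 < (p - 1) * n - 1 := by
    rw [div_lt_iff₀ (by linarith)] at hp
    linarith
  have hσ : 0 < sigma p := div_pos (by linarith) hq0
  have hval : (sigma p) ^ 2 - (n - 1 - p / beta N p) * sigma p - l < 0 := by
    -- Subtracting `l ≥ n` from this value leaves at most `1 - 1/(p-1) - n(p-1)`, negative because
    -- `0 < p - 1 < 1`.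
    have e : (sigma p) ^ 2 - (n - 1 - p / beta N p) * sigma p =
        n + 1 - 1 / (p - 1) - n * (p - 1) := by
      unfold sigma beta alpha
      rw [← hn]
      field_simp
      ring
    rw [e]
    have h1 : 1 < 1 / (p - 1) := by
      rw [lt_div_iff₀ hq0]
      linarith
    nlinarith
  have hc : ContinuousAt (fun τ : ℝ => τ ^ 2 - (n - 1 - p / beta N p) * τ - l) (sigma p) := by
    fun_prop
  obtain ⟨δ, hδ, hball⟩ := Metric.eventually_nhds_iff.1
    ((hc.eventually_lt_const hval).and (lt_mem_nhds hσ))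
  have hd1 : dist (sigma p + δ / 2) (sigma p) < δ := by
    rw [Real.dist_eq, add_sub_cancel_left, abs_of_pos (by positivity)]
    linarith
  have hd2 : dist (sigma p - δ / 2) (sigma p) < δ := by
    rw [Real.dist_eq, sub_sub_cancel_left, abs_neg, abs_of_pos (by positivity)]
    linarith
  exact ⟨δ / 2, by positivity, (hball hd2).2, (hball hd1).1, (hball hd2).1⟩

/-- The modes with positive eigenvalue of a solution in `X` vanish. -/
theorem modeCoeff_eq_zero {N : ℕ} (hN : 3 ≤ N) {p : ℝ} (hp : (N : ℝ) / ((N : ℝ) - 1) < p)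
    (hp2 : p < 2) {t R : ℝ≥0∞} {φ ψ : E N → ℝ} {l : ℝ} (hφ : MemX N p R φ)
    (hL : SolvesLt N p t R φ) (hψ : IsSphereEigenpair ψ l) (hl : 0 < l) :
    ∀ r ∈ radii R, modeCoeff φ ψ r = 0 := by
  -- An eigenpair may have `ψ = 0` on the sphere; the spectral gap says nothing then, but the
  -- coefficient is trivially zero.
  by_cases hne : ∃ θ : E N, ‖θ‖ = 1 ∧ ψ θ ≠ 0
  swap
  · push Not at hne
    intro r _
    unfold modeCoeff
    simp [hne _ (norm_coe_sphere _)]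
  obtain ⟨θ, hθ, hψθ⟩ := hne
  have hgap := hψ.eigenvalue_ge hN hl hθ hψθ
  obtain ⟨ε, hε, hε', hq₁, hq₂⟩ := exists_exponent_gap hN hp hp2 hgap
  have hβ := beta_pos hN hp
  have hN' : (3 : ℝ) ≤ N := by exact_mod_cast hN
  have hp0 : 0 < p := lt_trans (div_pos (by linarith) (by linarith)) hp
  -- For `τ > 0` the quadratic increases with the drift, so the case `p / β` controls every radius.
  have hq : ∀ τ, 0 < τ → τ ^ 2 - ((N : ℝ) - 1 - 1 - p / beta N p) * τ - l < 0 → ∀ r ∈ radii R,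
      τ ^ 2 - ((N : ℝ) - 1 - 1 - radialDrift N p t r * r ^ 2) * τ - l < 0 := by
    intro τ hτ h r hr
    have := mul_le_mul_of_nonneg_right (radialDrift_mul_sq_le (t := t) hβ hp0 hr.1) hτ.le
    linarith
  have hb := hasDerivAt_modeDeriv (by omega) hβ hφ hL hψ
  have ha : ∀ r ∈ radii R, HasDerivAt (modeCoeff φ ψ) (modeDeriv φ ψ r) r :=
    fun r hr => hφ.hasDerivAt_modeCoeff hψ hr
  have hac := hφ.continuousOn_modeCoeff hψ
  have ha0 : ∀ r ∈ closedRadii R, r ∉ radii R → modeCoeff φ ψ r = 0 :=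
    fun r hr hr' => hφ.modeCoeff_boundary hr hr'
  obtain ⟨C, hC⟩ := hφ.exists_abs_modeCoeff_le hψ
  have hle := radial_ode_nonpos hε ha hb hac ha0 (fun r hr => (le_abs_self _).trans (hC r hr))
    (hq _ (by linarith) hq₁) (hq _ hε' hq₂)
  -- The equation is linear and the bounds are symmetric, so the comparison applies to `-a`.
  have hge := radial_ode_nonpos (a := fun r => -modeCoeff φ ψ r) (b := fun r => -modeDeriv φ ψ r)
    (l := l) (c := fun r => radialDrift N p t r * r ^ 2) (n := (N : ℝ) - 1) hε
    (fun r hr => (ha r hr).fun_neg)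
    (fun r hr => (hb r hr).fun_neg.congr_deriv (by ring)) hac.fun_neg
    (fun r hr hr' => by simp [ha0 r hr hr'])
    (fun r hr => (neg_le_abs _).trans (hC r hr))
    (hq _ (by linarith) hq₁) (hq _ hε' hq₂)
  intro r hr
  exact le_antisymm (hle r hr) (by linarith [hge r hr])

/-! ### From vanishing modes to vanishing of the solution -/

/-- A continuous function that is an `L²` limit of combinations of functions orthogonal to it
vanishes. -/
lemma eq_zero_of_tendsto_of_orthogonal {N : ℕ} {f : Metric.sphere (0 : E N) 1 → ℝ}
    {s : ℕ → Metric.sphere (0 : E N) 1 → ℝ} (hf : Continuous f) (hs : ∀ n, Continuous (s n))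
    (horth : ∀ n, ∫ θ, f θ * s n θ ∂(sphereMeasure N) = 0)
    (hlim : Tendsto (fun n => ∫ θ, (f θ - s n θ) ^ 2 ∂(sphereMeasure N)) atTop (𝓝 0)) :
    f = 0 := by
  have hle : ∫ θ, f θ ^ 2 ∂(sphereMeasure N) ≤ 0 := by
    -- Pythagoras: `∫ (f - s n)² = ∫ f² + ∫ (s n)² ≥ ∫ f²`, while the left side tends to zero.
    refine ge_of_tendsto' hlim fun n => ?_
    have i1 := integrable_sphere (hf.fun_pow 2)
    have i2 := integrable_sphere (hf.fun_mul (hs n))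
    have i3 := integrable_sphere ((hs n).fun_pow 2)
    have e : ∫ θ, (f θ - s n θ) ^ 2 ∂(sphereMeasure N) =
        ∫ θ, f θ ^ 2 ∂(sphereMeasure N) + ∫ θ, s n θ ^ 2 ∂(sphereMeasure N) := by
      have h1 : ∀ θ, (f θ - s n θ) ^ 2 = f θ ^ 2 - 2 * (f θ * s n θ) + s n θ ^ 2 := fun θ => by ring
      have i4 : Integrable (fun θ => f θ ^ 2 - 2 * (f θ * s n θ)) (sphereMeasure N) :=
        i1.sub (i2.const_mul 2)
      rw [integral_congr_ae (Eventually.of_forall h1), integral_add i4 i3, integral_sub i1 (i2.const_mul 2),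
        integral_const_mul, horth n]
      ring
    rw [e]
    have : 0 ≤ ∫ θ, s n θ ^ 2 ∂(sphereMeasure N) := integral_nonneg fun θ => sq_nonneg _
    linarith
  have h0 : ∫ θ, f θ ^ 2 ∂(sphereMeasure N) = 0 :=
    le_antisymm hle (integral_nonneg fun θ => sq_nonneg _)
  have hae := (integral_eq_zero_iff_of_nonneg (fun θ => sq_nonneg (f θ))
    (integrable_sphere (hf.pow 2))).1 h0
  have := ((hf.fun_pow 2).ae_eq_iff_eq (sphereMeasure N) (g := fun _ => (0 : ℝ))
    continuous_const).1 hae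
  ext θ
  exact pow_eq_zero_iff two_ne_zero |>.1 (congrFun this θ)

/-- A solution in `X₁` vanishes. -/
theorem eq_zero_of_memX1 {N : ℕ} (hN : 3 ≤ N) {p : ℝ} (hp : (N : ℝ) / ((N : ℝ) - 1) < p)
    (hp2 : p < 2) {R t : ℝ≥0∞} {φ : E N → ℝ} (hφ : MemX1 N p R φ) (hL : SolvesLt N p t R φ) :
    ∀ x ∈ puncturedClosedBall N R, φ x = 0 := by
  intro x hx
  rcases hx.2.eq_or_lt with hxR | hxR
  · exact hφ.memX.boundary x hxR
  obtain ⟨ψ, l, a, hψ, hlim⟩ := hφ.expansion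
  have hr : ‖x‖ ∈ radii R := norm_mem_radii.2 ⟨hx.1, hxR⟩
  have hcont := hφ.memX.continuous_sphere (radii_subset_closedRadii R hr)
  have hs : ∀ k, Continuous fun θ : Metric.sphere (0 : E N) 1 => a k ‖x‖ * ψ k (θ : E N) :=
    fun k => continuous_const.mul (hψ.eigenpair k).continuous_sphere
  -- Only orthogonality of `φ` to each `ψ k` enters, so the coefficients `a k` need not be
  -- identified with the modes of `φ`.
  have horth : ∀ n, ∫ θ : Metric.sphere (0 : E N) 1, φ (‖x‖ • (θ : E N)) *
      ∑ k ∈ Finset.Icc 1 n, a k ‖x‖ * ψ k (θ : E N) ∂(sphereMeasure N) = 0 := by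
    intro n
    simp only [Finset.mul_sum]
    rw [integral_finsetSum _ fun k _ => integrable_sphere (hcont.fun_mul (hs k))]
    refine Finset.sum_eq_zero fun k hk => ?_
    have h0 := modeCoeff_eq_zero hN hp hp2 hφ.memX hL (hψ.eigenpair k)
      (hψ.pos k (Finset.mem_Icc.1 hk).1) ‖x‖ hr
    have h1 : ∀ θ : Metric.sphere (0 : E N) 1, φ (‖x‖ • (θ : E N)) * (a k ‖x‖ * ψ k (θ : E N)) =
        a k ‖x‖ * (φ (‖x‖ • (θ : E N)) * ψ k (θ : E N)) := fun θ => by ring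
    rw [integral_congr_ae (Eventually.of_forall h1), integral_const_mul]
    exact mul_eq_zero_of_right _ h0
  have hzero := eq_zero_of_tendsto_of_orthogonal hcont
    (fun n => continuous_finsetSum (Finset.Icc 1 n) fun k _ => hs k) horth (hlim ‖x‖ hr.1 hr.2)
  have hx0 : ‖x‖ ≠ 0 := norm_ne_zero_iff.2 hx.1
  have := congrFun hzero ⟨‖x‖⁻¹ • x, by simp [norm_smul, hx0]⟩
  simpa [smul_smul, hx0] using this

end SingularKernel

end

theorem mainTheorem8 (N : ℕ) (hN : 3 ≤ N) (p : ℝ) (hp : (N : ℝ) / ((N : ℝ) - 1) < p)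
    (hp2 : p < 2) (R : ℝ≥0∞) (hR : 0 < R) (t : ℝ≥0∞) (ht : 0 < t)
    (φ : SingularKernel.E N → ℝ) (hφ : SingularKernel.MemX1 N p R φ)
    (hL : SingularKernel.SolvesLt N p t R φ) :
    ∀ x ∈ SingularKernel.puncturedClosedBall N R, φ x = 0 := by
  exact SingularKernel.eq_zero_of_memX1 hN hp hp2 hφ hL
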